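/- Let $n\ge 1$ and $0\le p\le n$, and let $\Lambda^p$ be the space of complex-valued $p$-forms with constant coefficients on Euclidean space $\mathbb{R}^n$. For $x\in\mathbb{R}^n$ let $i_x$ and $\varepsilon_x$ be the interior and exterior multiplication by $x$ (with $i_x=0$ on $\Lambda^0$), and let $r(x)=|x|$. For $a,b\in\mathbb{C}$ and $\lambda\in\mathbb{C}$ with $\operatorname{Re}\lambda>-n$, the locally integrable function $$R^\lambda_{a,b}(x)=r^{\lambda-2}(x)\,(a\, i_x\varepsilon_x+b\,\varepsilon_x i_x)$$ defines a tempered distribution on $\mathbb{R}^n$ with values in $\operatorname{End}(\Lambda^p)$. The Fourier transform is $\mathcal{F}(\varphi)(\xi)=\int_{\mathbb{R}^n}\varphi(x)e^{i\langle x,\xi\rangle}\,dx$ on Schwartz functions $\varphi$, and $\mathcal{F}(T)(\varphi)=T(\mathcal{F}\varphi)$ on tempered distributions $T$. **Theorem.** (a) The family extends to tempered distributions $R^\lambda_{a,b}$ for all $\lambda\in\mathbb{C}\setminus\{-n,-n-2,-n-4,\dots\}$ such that, for all entire functions $A_\lambda,B_\lambda$ of $\lambda$ and every Schwartz function $\varphi$,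 the function $\lambda\mapsto R^\lambda_{A_\lambda,B_\lambda}(\varphi)$ is holomorphic on this set and meromorphic on $\mathbb{C}$. (Such an extension is unique.) (b) Let $A_\lambda,B_\lambda$ be entire functions of $\lambda$ (which may depend on $n$ and $p$), and put $$C_\lambda=(\lambda+p)A_\lambda-pB_\lambda,\qquad D_\lambda=-(n-p)A_\lambda+(\lambda+n-p)B_\lambda .$$ Then $$\mathcal{F}(R^\lambda_{A_\lambda,B_\lambda})=-2^{\lambda+n-1}\pi^{n/2}\,\frac{\Gamma\big(\frac{\lambda+n}{2}\big)}{\Gamma\big(-\frac{\lambda-2}{2}\big)}\,R^{-\lambda-n}_{C_\lambda,D_\lambda}$$ for all $\lambda\in\mathbb{C}$ with $\lambda\notin\{-n-2k: k=0,1,2,\dots\}$ and $\lambda\notin\{0,2,4,\dots\}$. For $\lambda_0\in\{0,2,4,\dots\}$, $\mathcal{F}(R^{\lambda_0}_{A_{\lambda_0},B_{\lambda_0}})$ is the limit of the right-hand side, evaluated on any Schwartz function, as $\lambda\to\lambda_0$ with $\lambda\neq\lambda_0$. In particular the two sides agree as meromorphic families of tempered distributions on $\mathbb{C}$. -/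

import Mathlib

open Filter Topology MeasureTheory
open scoped SchwartzMap FourierTransform

noncomputable section

/-- The Euclidean space `ℝⁿ`. -/
abbrev Euc (n : ℕ) : Type := EuclideanSpace ℝ (Fin n)

/-- Constant-coefficient (complex valued) `p`-forms on `ℝⁿ`. -/
def FormSpace (n p : ℕ) : Type := Euc n [⋀^Fin p]→L[ℝ] ℂ

instance (n p : ℕ) : NormedAddCommGroup (FormSpace n p) :=
  inferInstanceAs (NormedAddCommGroup (Euc n [⋀^Fin p]→L[ℝ] ℂ))

instance (n p : ℕ) : NormedSpace ℂ (FormSpace n p) :=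
  inferInstanceAs (NormedSpace ℂ (Euc n [⋀^Fin p]→L[ℝ] ℂ))

instance (n p : ℕ) : CompleteSpace (FormSpace n p) :=
  inferInstanceAs (CompleteSpace (Euc n [⋀^Fin p]→L[ℝ] ℂ))

/-- Endomorphisms of the space of `p`-forms on `ℝⁿ`. -/
abbrev FormEnd (n p : ℕ) : Type := FormSpace n p →L[ℂ] FormSpace n p

/-- Interior product as a map on alternating forms: `i_x ω = ω(x, ·, …, ·)`. -/
def interiorAlt {n p : ℕ} (x : Euc n) (ω : Euc n [⋀^Fin (p + 1)]→L[ℝ] ℂ) :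
    Euc n [⋀^Fin p]→L[ℝ] ℂ :=
  ω.curryLeft x

/-- Exterior product as a map on alternating forms: `ε_x ω = x ∧ ω`, where `x` is identified with
the one-form `⟨x, ·⟩`, that is
`(x ∧ ω)(v₀, …, v_p) = ∑ i, (-1)^i ⟨x, v_i⟩ ω(v₀, …, v̂_i, …, v_p)`. -/
def exteriorAlt {n p : ℕ} (x : Euc n) (ω : Euc n [⋀^Fin p]→L[ℝ] ℂ) :
    Euc n [⋀^Fin (p + 1)]→L[ℝ] ℂ :=
  ContinuousAlternatingMap.alternatizeUncurryFin ((innerSL ℝ x).smulRight ω)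

theorem interiorAlt_apply {n p : ℕ} (x : Euc n) (ω : Euc n [⋀^Fin (p + 1)]→L[ℝ] ℂ)
    (v : Fin p → Euc n) : interiorAlt x ω v = ω (Fin.cons x v) := rfl

theorem exteriorAlt_apply {n p : ℕ} (x : Euc n) (ω : Euc n [⋀^Fin p]→L[ℝ] ℂ)
    (v : Fin (p + 1) → Euc n) :
    exteriorAlt x ω v =
      ∑ i : Fin (p + 1), (-1) ^ (i : ℕ) * ((inner ℝ x (v i) : ℝ) : ℂ) * ω (i.removeNth v) := by
  simp [exteriorAlt, ContinuousAlternatingMap.alternatizeUncurryFin_apply, mul_assoc]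

theorem exteriorAlt_add {n p : ℕ} (x : Euc n) (ω η : Euc n [⋀^Fin p]→L[ℝ] ℂ) :
    exteriorAlt x (ω + η) = exteriorAlt x ω + exteriorAlt x η := by
  ext v
  simp [exteriorAlt_apply, mul_add, Finset.sum_add_distrib]

theorem exteriorAlt_smul {n p : ℕ} (x : Euc n) (c : ℂ) (ω : Euc n [⋀^Fin p]→L[ℝ] ℂ) :
    exteriorAlt x (c • ω) = c • exteriorAlt x ω := by
  ext v
  simp [exteriorAlt_apply, Finset.mul_sum, mul_left_comm]

theorem norm_interiorAlt_le {n p : ℕ} (x : Euc n) (ω : Euc n [⋀^Fin (p + 1)]→L[ℝ] ℂ) :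
    ‖interiorAlt x ω‖ ≤ ‖x‖ * ‖ω‖ := by
  have h := ω.curryLeft.le_opNorm x
  rwa [ContinuousAlternatingMap.norm_curryLeft, mul_comm] at h

theorem norm_exteriorAlt_le {n p : ℕ} (x : Euc n) (ω : Euc n [⋀^Fin p]→L[ℝ] ℂ) :
    ‖exteriorAlt x ω‖ ≤ ((p + 1) * ‖x‖) * ‖ω‖ := by
  have h := ContinuousAlternatingMap.norm_alternatizeUncurryFin_le ((innerSL ℝ x).smulRight ω)
  rwa [ContinuousLinearMap.norm_smulRight_apply, innerSL_apply_norm, ← mul_assoc] at h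

/-- The interior product `i_x` as a linear map from `(p+1)`-forms to `p`-forms. -/
def interiorProd (n p : ℕ) (x : Euc n) : FormSpace n (p + 1) →L[ℂ] FormSpace n p :=
  LinearMap.mkContinuous
    { toFun := fun ω => interiorAlt x ω
      map_add' := fun _ _ => rfl
      map_smul' := fun _ _ => rfl }
    ‖x‖ (fun ω => norm_interiorAlt_le x ω)

/-- The exterior product `ε_x` as a linear map from `p`-forms to `(p+1)`-forms. -/
def exteriorProd (n p : ℕ) (x : Euc n) : FormSpace n p →L[ℂ] FormSpace n (p + 1) :=
  LinearMap.mkContinuous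
    { toFun := fun ω => exteriorAlt x ω
      map_add' := fun ω η => exteriorAlt_add x ω η
      map_smul' := fun c ω => exteriorAlt_smul x c ω }
    ((p + 1) * ‖x‖) (fun ω => norm_exteriorAlt_le x ω)

/-- The endomorphism `i_x ε_x` of `p`-forms. -/
def intExt (n p : ℕ) (x : Euc n) : FormEnd n p :=
  (interiorProd n p x).comp (exteriorProd n p x)

/-- The endomorphism `ε_x i_x` of `p`-forms (zero on functions, on which `i_x` vanishes). -/
def extInt (n : ℕ) : (p : ℕ) → Euc n → FormEnd n p
  | 0, _ => 0
  | q + 1, x => (exteriorProd n q x).comp (interiorProd n q x)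

/-- The function `x ↦ r^{s-2}(x) (a i_x ε_x + b ε_x i_x)` on `ℝⁿ`, with `r(x) = |x|`. -/
def rieszKernel (n p : ℕ) (a b s : ℂ) (x : Euc n) : FormEnd n p :=
  ((‖x‖ : ℂ) ^ (s - 2)) • (a • intExt n p x + b • extInt n p x)

/-- The set `{-n, -n-2, -n-4, …}` of poles. -/
def rieszPoles (n : ℕ) : Set ℂ := {s | ∃ k : ℕ, s = -(n : ℂ) - 2 * (k : ℂ)}

/-- `R a b s` is the Riesz distribution `R^s_{a,b}`, a tempered distribution on `ℝⁿ` with values in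
the endomorphisms of `p`-forms: for `Re s > -n` it is integration against the (locally integrable)
kernel, and for other `s` it is defined by meromorphic continuation in `s`; the continuation of
`s ↦ R^s_{A(s),B(s)}`, with `A`, `B` entire, is holomorphic outside `{-n, -n-2, …}`.
By the identity theorem, `R a b s` is determined by these conditions for all `s` outside this set;
nothing is said on `R a b s` for `s` inside. -/
structure IsRieszFamily (n p : ℕ) (R : ℂ → ℂ → ℂ → 𝓢'(Euc n, FormEnd n p)) : Prop where
  integrable : ∀ a b s : ℂ, -(n : ℝ) < s.re → ∀ φ : 𝓢(Euc n, ℂ),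
    Integrable (fun x => φ x • rieszKernel n p a b s x)
  eq_integral : ∀ a b s : ℂ, -(n : ℝ) < s.re → ∀ φ : 𝓢(Euc n, ℂ),
    R a b s φ = ∫ x, φ x • rieszKernel n p a b s x
  analyticAt : ∀ A B : ℂ → ℂ, Differentiable ℂ A → Differentiable ℂ B →
    ∀ φ : 𝓢(Euc n, ℂ), ∀ s ∉ rieszPoles n, AnalyticAt ℂ (fun t => R (A t) (B t) t φ) s
  meromorphicAt : ∀ A B : ℂ → ℂ, Differentiable ℂ A → Differentiable ℂ B →
    ∀ φ : 𝓢(Euc n, ℂ), ∀ s : ℂ, MeromorphicAt (fun t => R (A t) (B t) t φ) s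

/-- The Fourier transform `(F φ)(ξ) = ∫ φ(x) e^{i⟨x,ξ⟩} dx` on Schwartz functions, written as
Mathlib's transform (with the character `e^{-2πi⟨x,ξ⟩}`) followed by the dilation
`ξ ↦ -(2π)⁻¹ ξ`; see `schwartzFourier_apply`. -/
def schwartzFourier (n : ℕ) : 𝓢(Euc n, ℂ) →L[ℂ] 𝓢(Euc n, ℂ) :=
  (SchwartzMap.compCLMOfContinuousLinearEquiv ℂ
    (ContinuousLinearEquiv.smulLeft
      (Units.mk0 (-(2 * Real.pi)⁻¹ : ℝ)
        (neg_ne_zero.mpr (inv_ne_zero Real.two_pi_pos.ne'))) : Euc n ≃L[ℝ] Euc n)).comp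
  (FourierTransform.fourierCLM ℂ 𝓢(Euc n, ℂ))

theorem schwartzFourier_apply (n : ℕ) (φ : 𝓢(Euc n, ℂ)) (ξ : Euc n) :
    schwartzFourier n φ ξ = ∫ x, φ x * Complex.exp (Complex.I * (inner ℝ x ξ : ℝ)) := by
  have h : schwartzFourier n φ ξ = 𝓕 (φ : Euc n → ℂ) (-(2 * Real.pi)⁻¹ • ξ) := rfl
  rw [h, Real.fourier_eq']
  refine integral_congr_ae (Eventually.of_forall fun x => ?_)
  have hpi : (Real.pi : ℂ) ≠ 0 := Complex.ofReal_ne_zero.mpr Real.pi_ne_zero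
  simp only [inner_smul_right, smul_eq_mul]
  rw [mul_comm]
  congr 2
  push_cast
  field_simp

/-- The Fourier transform of vector valued tempered distributions, `(F T)(φ) = T(F φ)`. -/
def distFourier (n : ℕ) {V : Type*} [NormedAddCommGroup V] [NormedSpace ℂ V]
    (T : 𝓢'(Euc n, V)) : 𝓢'(Euc n, V) :=
  PointwiseConvergenceCLM.precomp V (schwartzFourier n) T

/-- The constant `-2^{s+n-1} π^{n/2} Γ((s+n)/2) / Γ(-(s-2)/2)`. -/
def rieszFourierConst (n : ℕ) (s : ℂ) : ℂ :=
  -((2 : ℂ) ^ (s + n - 1) * (Real.pi : ℂ) ^ ((n : ℂ) / 2) *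
    (Complex.Gamma ((s + n) / 2) / Complex.Gamma (-(s - 2) / 2)))

end

noncomputable section

/-! Everything reduces to scalar kernels. The relation `i_x ε_x + ε_x i_x = |x|²`
(`intExt_add_extInt`) gives `R^s_{a,b} = ∑ |x|^{s-2} x_j x_k N_{jk}` with constant matrices `N_{jk}
= a δ_{jk} + (b - a) ε_j i_k`. In the strip `-n < Re s < 0` the transform of `|x|^{s-2} x_j x_k` is
a multiple of `δ_{jk} |ξ|^{-s-n} - (s+n) |ξ|^{-s-n-2} ξ_j ξ_k`
(`integral_pairKernel_mul_schwartzFourier`): differentiate the transform of a Gaussian twice, then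
integrate over its width `t` against `t^{-s/2}`; Gamma integrals appear on both sides. Contracting
with `N_{jk}` and using `∑ ε_j i_j = p` (`sum_extIntPair_basisVec`) turns the `δ` term into a
multiple of the identity, and `C`, `D` can be read off.

The functional equation then supplies the continuation. If `Re s < 0`, the reflected exponent `-s-n`
has real part above `-n`, so `R^s_{a,b}` may be defined as `(2π)^{-n} c(s)` times the transform of
`R^{-s-n}_{C,D}`, where `c` is `rieszFourierConst`. The two definitions agree in the strip, because
applying the functional equation twice gives `(2π)^n` (`rieszFourierConst_mul_reflect`). The only
poles are those of `Γ((s+n)/2)`.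

For an arbitrary family with the defining properties, both sides of (b) are analytic off a countable
set, whose complement is connected, and they agree in the strip; the identity theorem does the rest.
At `s = 2k` the left side is still continuous, which gives the limit. -/

/-! ### Integrability of powers of the norm against Schwartz functions. -/

theorem integrable_norm_rpow_mul_inv_one_add_pow {n : ℕ} (hn : 1 ≤ n) {σ : ℝ} (hσ : -(n : ℝ) < σ) :
    ∃ N : ℕ, Integrable (fun x : Euc n => ‖x‖ ^ σ * ((1 + ‖x‖) ^ N)⁻¹) := by
  have : Nonempty (Fin n) := ⟨⟨0, hn⟩⟩
  obtain ⟨N, hN⟩ := exists_nat_gt (σ + n)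
  refine ⟨N, ?_⟩
  rw [integrable_fun_norm_addHaar (μ := volume) (E := Euc n)
    (f := fun r : ℝ => r ^ σ * ((1 + r) ^ N)⁻¹)]
  have hmeas : Measurable (fun y : ℝ => y ^ (Module.finrank ℝ (Euc n) - 1) •
      (y ^ σ * ((1 + y) ^ N)⁻¹)) := by fun_prop
  have hpow : ∀ y : ℝ, 0 < y → y ^ (Module.finrank ℝ (Euc n) - 1) • (y ^ σ * ((1 + y) ^ N)⁻¹)
      = y ^ (σ + n - 1) * ((1 + y) ^ N)⁻¹ := by
    intro y hy
    rw [finrank_euclideanSpace_fin, smul_eq_mul, ← mul_assoc, ← Real.rpow_natCast,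
      ← Real.rpow_add hy, Nat.cast_sub hn]
    congr 2
    push_cast; ring
  -- In polar coordinates the density is `r^{σ+n-1} (1+r)^{-N}`: integrable at `0` because `σ > -n`,
  -- and at infinity because `N > σ + n`.
  rw [← Set.Ioc_union_Ioi_eq_Ioi (zero_le_one' ℝ), integrableOn_union]
  constructor
  · have h : IntegrableOn (fun y : ℝ => y ^ (σ + n - 1)) (Set.Ioc 0 1) := by
      rw [← intervalIntegrable_iff_integrableOn_Ioc_of_le zero_le_one]
      exact intervalIntegral.intervalIntegrable_rpow' (by linarith)
    refine Integrable.mono' h hmeas.aestronglyMeasurable ?_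
    filter_upwards [ae_restrict_mem measurableSet_Ioc] with y hy
    have hy0 : 0 < y := hy.1
    rw [hpow y hy0, Real.norm_of_nonneg (by positivity)]
    refine mul_le_of_le_one_right (by positivity) (inv_le_one_of_one_le₀ ?_)
    exact one_le_pow₀ (by linarith)
  · have h : IntegrableOn (fun y : ℝ => y ^ (σ + n - 1 - N)) (Set.Ioi 1) :=
      integrableOn_Ioi_rpow_of_lt (by linarith) one_pos
    refine Integrable.mono' h hmeas.aestronglyMeasurable ?_
    filter_upwards [ae_restrict_mem measurableSet_Ioi] with y hy
    have hy0 : 0 < y := lt_trans one_pos hy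
    rw [hpow y hy0, Real.norm_of_nonneg (by positivity), Real.rpow_sub hy0 _ (N : ℝ), div_eq_mul_inv,
      Real.rpow_natCast]
    gcongr
    linarith

theorem SchwartzMap.norm_apply_le_sup_seminorm_mul {n : ℕ} (N : ℕ) (φ : 𝓢(Euc n, ℂ)) (x : Euc n) :
    ‖φ x‖ ≤ (2 ^ N * (Finset.Iic (N, 0)).sup (schwartzSeminormFamily ℂ (Euc n) ℂ) φ) *
      ((1 + ‖x‖) ^ N)⁻¹ := by
  have h := SchwartzMap.one_add_le_sup_seminorm_apply (𝕜 := ℂ) (m := (N, 0)) (k := N) (n := 0)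
    le_rfl le_rfl φ x
  rw [norm_iteratedFDeriv_zero] at h
  have h0 : 0 < (1 + ‖x‖) ^ N := by positivity
  rw [← div_eq_mul_inv, le_div_iff₀ h0, mul_comm]
  exact h

theorem SchwartzMap.integrable_norm_rpow_mul_norm {n : ℕ} (hn : 1 ≤ n) {σ : ℝ}
    (hσ : -(n : ℝ) < σ) (φ : 𝓢(Euc n, ℂ)) :
    Integrable (fun x : Euc n => ‖x‖ ^ σ * ‖φ x‖) := by
  obtain ⟨N, hN⟩ := integrable_norm_rpow_mul_inv_one_add_pow hn hσ
  refine Integrable.mono' (hN.const_mul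
    (2 ^ N * (Finset.Iic (N, 0)).sup (schwartzSeminormFamily ℂ (Euc n) ℂ) φ)) ?_
    (Eventually.of_forall fun x => ?_)
  · have h1 : Measurable (fun x : Euc n => ‖x‖ ^ σ) := by fun_prop
    exact (h1.mul φ.continuous.norm.measurable).aestronglyMeasurable
  · rw [Real.norm_of_nonneg (by positivity)]
    rw [mul_left_comm]
    gcongr
    exact SchwartzMap.norm_apply_le_sup_seminorm_mul N φ x

/-! ### Scalar kernels: bounds, continuity on Schwartz space, holomorphy in the exponent. -/

/-- The scalar homogeneous kernel `x ↦ |x|^{s-2} ⟨u, x⟩ ⟨v, x⟩`. -/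
def pairKernel {n : ℕ} (u v : Euc n) (s : ℂ) (x : Euc n) : ℂ :=
  (‖x‖ : ℂ) ^ (s - 2) * ((inner ℝ u x : ℝ) * (inner ℝ v x : ℝ) : ℂ)

theorem measurable_pairKernel {n : ℕ} (u v : Euc n) (s : ℂ) : Measurable (pairKernel u v s) := by
  unfold pairKernel
  fun_prop

/-- The inner products kill the value at the origin even when `s = 2`, where the power is `0 ^ 0 =
1`; hence the bound `norm_pairKernel_le` needs no exception. -/
theorem pairKernel_zero {n : ℕ} (u v : Euc n) (s : ℂ) : pairKernel u v s 0 = 0 := by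
  simp [pairKernel]

theorem norm_pairKernel_le_mul {n : ℕ} (u v : Euc n) (s : ℂ) {x : Euc n} (hx : x ≠ 0) :
    ‖pairKernel u v s x‖ ≤ ‖x‖ ^ (s.re - 2) * (‖u‖ * ‖v‖ * ‖x‖ ^ 2) := by
  have hx' : 0 < ‖x‖ := norm_pos_iff.mpr hx
  rw [pairKernel, norm_mul, Complex.norm_cpow_eq_rpow_re_of_pos hx', norm_mul,
    Complex.norm_real, Complex.norm_real]
  simp only [Complex.sub_re, Complex.re_ofNat]
  refine mul_le_mul_of_nonneg_left ?_ (by positivity)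
  calc ‖(inner ℝ u x : ℝ)‖ * ‖(inner ℝ v x : ℝ)‖ ≤ (‖u‖ * ‖x‖) * (‖v‖ * ‖x‖) := by
        gcongr <;> exact norm_inner_le_norm _ _
    _ = _ := by ring

theorem norm_pairKernel_le {n : ℕ} (u v : Euc n) (s : ℂ) (x : Euc n) :
    ‖pairKernel u v s x‖ ≤ ‖u‖ * ‖v‖ * ‖x‖ ^ s.re := by
  rcases eq_or_ne x 0 with rfl | hx
  · rw [pairKernel_zero, norm_zero]
    positivity
  have hx' : 0 < ‖x‖ := norm_pos_iff.mpr hx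
  refine (norm_pairKernel_le_mul u v s hx).trans_eq ?_
  rw [Real.rpow_sub hx', Real.rpow_two]
  field_simp

theorem integrable_pairKernel_mul {n : ℕ} (hn : 1 ≤ n) (u v : Euc n) {s : ℂ}
    (hs : -(n : ℝ) < s.re) (φ : 𝓢(Euc n, ℂ)) :
    Integrable (fun x => pairKernel u v s x * φ x) := by
  refine Integrable.mono'
    ((SchwartzMap.integrable_norm_rpow_mul_norm hn hs φ).const_mul (‖u‖ * ‖v‖)) ?_
    (Eventually.of_forall fun x => ?_)
  · exact ((measurable_pairKernel u v s).mul φ.continuous.measurable).aestronglyMeasurable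
  · rw [norm_mul, ← mul_assoc]
    gcongr
    exact norm_pairKernel_le u v s x

/-- Integration against `pairKernel u v s`, as a continuous functional on Schwartz functions. -/
def pairFunctional {n : ℕ} (hn : 1 ≤ n) (u v : Euc n) (s : ℂ) (hs : -(n : ℝ) < s.re) :
    𝓢(Euc n, ℂ) →L[ℂ] ℂ :=
  SchwartzMap.mkCLMtoNormedSpace (fun φ => ∫ x, pairKernel u v s x * φ x)
    (fun φ ψ => by
      simp only [add_apply, mul_add]
      exact integral_add (integrable_pairKernel_mul hn u v hs φ)
        (integrable_pairKernel_mul hn u v hs ψ))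
    (fun c φ => by
      simp only [smul_apply, smul_eq_mul, RingHom.id_apply, mul_left_comm _ c]
      exact integral_const_mul _ _)
    (by
      obtain ⟨N, hN⟩ := integrable_norm_rpow_mul_inv_one_add_pow hn hs
      refine ⟨Finset.Iic (N, 0),
        ‖u‖ * ‖v‖ * 2 ^ N * ∫ x : Euc n, ‖x‖ ^ s.re * ((1 + ‖x‖) ^ N)⁻¹, by positivity,
        fun φ => ?_⟩
      set S := (Finset.Iic (N, 0)).sup (schwartzSeminormFamily ℂ (Euc n) ℂ) φ
      calc ‖∫ x, pairKernel u v s x * φ x‖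
          ≤ ∫ x : Euc n, (‖u‖ * ‖v‖ * 2 ^ N * S) * (‖x‖ ^ s.re * ((1 + ‖x‖) ^ N)⁻¹) := by
            refine norm_integral_le_of_norm_le (hN.const_mul _) (Eventually.of_forall fun x => ?_)
            rw [norm_mul]
            calc _ ≤ (‖u‖ * ‖v‖ * ‖x‖ ^ s.re) * ((2 ^ N * S) * ((1 + ‖x‖) ^ N)⁻¹) := by
                  gcongr
                  · exact norm_pairKernel_le u v s x
                  · exact SchwartzMap.norm_apply_le_sup_seminorm_mul N φ x
              _ = _ := by ring
        _ = _ := by rw [integral_const_mul]; ring)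

theorem pairFunctional_apply {n : ℕ} (hn : 1 ≤ n) (u v : Euc n) (s : ℂ) (hs : -(n : ℝ) < s.re)
    (φ : 𝓢(Euc n, ℂ)) :
    pairFunctional hn u v s hs φ = ∫ x, pairKernel u v s x * φ x := rfl

theorem Real.rpow_le_rpow_add_rpow_of_mem_Icc {r a b c : ℝ} (hr : 0 < r) (hb : b ≤ a) (hc : a ≤ c) :
    r ^ a ≤ r ^ b + r ^ c := by
  have h1 := Real.rpow_nonneg hr.le b
  have h2 := Real.rpow_nonneg hr.le c
  rcases le_total r 1 with h | h
  · linarith [Real.rpow_le_rpow_of_exponent_ge hr h hb]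
  · linarith [Real.rpow_le_rpow_of_exponent_le h hc]

theorem Real.abs_log_le_rpow_add_rpow_neg {r ε : ℝ} (hr : 0 < r) (hε : 0 < ε) :
    |Real.log r| ≤ (r ^ ε + r ^ (-ε)) / ε := by
  have h1 := Real.log_le_rpow_div hr.le hε
  have h2 := Real.log_le_rpow_div (inv_nonneg.mpr hr.le) hε
  rw [Real.log_inv, Real.inv_rpow hr.le, ← Real.rpow_neg hr.le] at h2
  have h3 : 0 ≤ r ^ ε / ε := by positivity
  have h4 : 0 ≤ r ^ (-ε) / ε := by positivity
  rw [add_div, abs_le]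
  constructor <;> linarith

theorem hasDerivAt_pairKernel {n : ℕ} (u v : Euc n) (s : ℂ) (x : Euc n) :
    HasDerivAt (fun t => pairKernel u v t x) ((Real.log ‖x‖ : ℂ) * pairKernel u v s x) s := by
  rcases eq_or_ne x 0 with rfl | hx
  · simp only [pairKernel_zero, mul_zero]
    exact hasDerivAt_const _ _
  have hx' : (‖x‖ : ℂ) ≠ 0 := by simpa using hx
  have h : HasDerivAt (fun t : ℂ => (‖x‖ : ℂ) ^ (t - 2))
      ((‖x‖ : ℂ) ^ (s - 2) * Complex.log ‖x‖ * 1) s :=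
    ((hasDerivAt_id s).sub_const 2).const_cpow (Or.inl hx')
  convert! h.mul_const ((inner ℝ u x : ℝ) * (inner ℝ v x : ℝ) : ℂ) using 1
  rw [pairKernel, Complex.ofReal_log (norm_nonneg x)]
  ring

/-- Differentiation under the integral produces a factor `log ‖x‖`, absorbed by an arbitrarily small
loss in the exponent. -/
theorem differentiableAt_integral_pairKernel {n : ℕ} (hn : 1 ≤ n) (u v : Euc n) {s : ℂ}
    (hs : -(n : ℝ) < s.re) (φ : 𝓢(Euc n, ℂ)) :
    DifferentiableAt ℂ (fun t => ∫ x, pairKernel u v t x * φ x) s := by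
  -- One `ε` is spent on moving `t` in the ball, a second on the logarithm; the exponents then lie
  -- within `2ε` of `Re s`, still above `-n`.
  obtain ⟨ε, hε, hε2⟩ : ∃ ε : ℝ, 0 < ε ∧ -(n : ℝ) < s.re - 2 * ε :=
    ⟨(s.re + n) / 4, by linarith, by linarith⟩
  have hlo := SchwartzMap.integrable_norm_rpow_mul_norm hn hε2 φ
  have hhi := SchwartzMap.integrable_norm_rpow_mul_norm hn
    (show -(n : ℝ) < s.re + 2 * ε by linarith) φ
  have hmeas : ∀ t : ℂ, AEStronglyMeasurable (fun x => pairKernel u v t x * φ x) volume :=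
    fun t => ((measurable_pairKernel u v t).mul φ.continuous.measurable).aestronglyMeasurable
  have key := hasDerivAt_integral_of_dominated_loc_of_deriv_le (μ := (volume : Measure (Euc n)))
    (F := fun t x => pairKernel u v t x * φ x)
    (F' := fun t x => (Real.log ‖x‖ : ℂ) * pairKernel u v t x * φ x)
    (bound := fun x => ‖u‖ * ‖v‖ * (2 / ε) *
      (‖x‖ ^ (s.re - 2 * ε) * ‖φ x‖ + ‖x‖ ^ (s.re + 2 * ε) * ‖φ x‖))
    (Metric.ball_mem_nhds s hε) (Eventually.of_forall hmeas)
    (integrable_pairKernel_mul hn u v hs φ) ?_ ?_ ((hlo.add hhi).const_mul _) ?_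
  · exact key.2.differentiableAt
  · have h1 : Measurable (fun x : Euc n => (Real.log ‖x‖ : ℂ)) := by fun_prop
    exact ((h1.mul (measurable_pairKernel u v s)).mul
      φ.continuous.measurable).aestronglyMeasurable
  · refine Eventually.of_forall fun x t ht => ?_
    rcases eq_or_ne x 0 with rfl | hx
    · simp only [pairKernel_zero, mul_zero, zero_mul, norm_zero]
      positivity
    have hr : 0 < ‖x‖ := norm_pos_iff.mpr hx
    have hre : |t.re - s.re| < ε := by
      rw [Metric.mem_ball, dist_eq_norm] at ht
      exact lt_of_le_of_lt (by simpa using Complex.abs_re_le_norm (t - s)) ht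
    rw [abs_lt] at hre
    rw [norm_mul, norm_mul, Complex.norm_real, Real.norm_eq_abs]
    have hlog := Real.abs_log_le_rpow_add_rpow_neg hr hε
    have hk := norm_pairKernel_le u v t x
    have e1 : ‖x‖ ^ ε * ‖x‖ ^ t.re ≤ ‖x‖ ^ (s.re - 2 * ε) + ‖x‖ ^ (s.re + 2 * ε) := by
      rw [← Real.rpow_add hr]
      exact Real.rpow_le_rpow_add_rpow_of_mem_Icc hr (by linarith) (by linarith)
    have e2 : ‖x‖ ^ (-ε) * ‖x‖ ^ t.re ≤ ‖x‖ ^ (s.re - 2 * ε) + ‖x‖ ^ (s.re + 2 * ε) := by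
      rw [← Real.rpow_add hr]
      exact Real.rpow_le_rpow_add_rpow_of_mem_Icc hr (by linarith) (by linarith)
    calc |Real.log ‖x‖| * ‖pairKernel u v t x‖ * ‖φ x‖
        ≤ ((‖x‖ ^ ε + ‖x‖ ^ (-ε)) / ε) * (‖u‖ * ‖v‖ * ‖x‖ ^ t.re) * ‖φ x‖ := by gcongr
      _ = ‖u‖ * ‖v‖ / ε * (‖x‖ ^ ε * ‖x‖ ^ t.re + ‖x‖ ^ (-ε) * ‖x‖ ^ t.re) * ‖φ x‖ := by ring
      _ ≤ ‖u‖ * ‖v‖ / ε * ((‖x‖ ^ (s.re - 2 * ε) + ‖x‖ ^ (s.re + 2 * ε)) +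
          (‖x‖ ^ (s.re - 2 * ε) + ‖x‖ ^ (s.re + 2 * ε))) * ‖φ x‖ := by gcongr
      _ = _ := by ring
  · exact Eventually.of_forall fun x t _ => (hasDerivAt_pairKernel u v t x).mul_const _

/-! ### Fourier transforms of Gaussians with linear and quadratic factors. -/

theorem integrable_norm_pow_mul_exp_neg_mul_sq {n : ℕ} (hn : 1 ≤ n) {t : ℝ} (ht : 0 < t) (k : ℕ) :
    Integrable (fun x : Euc n => ‖x‖ ^ k * Real.exp (-t * ‖x‖ ^ 2)) := by
  have : Nonempty (Fin n) := ⟨⟨0, hn⟩⟩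
  rw [integrable_fun_norm_addHaar (μ := volume) (E := Euc n)
    (f := fun r : ℝ => r ^ k * Real.exp (-t * r ^ 2))]
  have h := integrableOn_rpow_mul_exp_neg_mul_sq ht
    (s := ((Module.finrank ℝ (Euc n) - 1 + k : ℕ) : ℝ))
    (lt_of_lt_of_le (by norm_num) (Nat.cast_nonneg _))
  simp only [Real.rpow_natCast, pow_add, mul_assoc] at h
  exact h

/-- Each directional derivative in the frequency brings down a factor `i⟨u, x⟩`. Two applications to
the Gaussian produce the quadratic factor. -/
theorem hasDerivAt_integral_mul_cexp_inner {n : ℕ} {f : Euc n → ℂ} (hf : Integrable f)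
    (hf1 : Integrable (fun x => ‖x‖ * ‖f x‖)) (u ξ : Euc n) :
    HasDerivAt (fun a : ℝ => ∫ x, f x * Complex.exp (Complex.I * (inner ℝ (ξ + a • u) x : ℝ)))
      (∫ x, Complex.I * (inner ℝ u x : ℝ) * f x * Complex.exp (Complex.I * (inner ℝ ξ x : ℝ)))
      0 := by
  have hmeas : ∀ w : Euc n, AEStronglyMeasurable
      (fun x => f x * Complex.exp (Complex.I * (inner ℝ w x : ℝ))) volume := fun w =>
    hf.aestronglyMeasurable.mul (Continuous.aestronglyMeasurable (by fun_prop))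
  have hn : ∀ w x : Euc n, ‖Complex.exp (Complex.I * (inner ℝ w x : ℝ))‖ = 1 := fun w x => by
    rw [mul_comm]; exact Complex.norm_exp_ofReal_mul_I _
  have key := hasDerivAt_integral_of_dominated_loc_of_deriv_le (μ := (volume : Measure (Euc n)))
    (F := fun (a : ℝ) x => f x * Complex.exp (Complex.I * (inner ℝ (ξ + a • u) x : ℝ)))
    (F' := fun (a : ℝ) x => Complex.I * (inner ℝ u x : ℝ) * f x *
      Complex.exp (Complex.I * (inner ℝ (ξ + a • u) x : ℝ)))
    (x₀ := 0) (bound := fun x => ‖u‖ * (‖x‖ * ‖f x‖)) univ_mem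
    (Eventually.of_forall fun a => hmeas _) ?_ ?_ ?_ (hf1.const_mul _) ?_
  · simpa using key.2
  · refine hf.norm.mono' (hmeas _) (Eventually.of_forall fun x => ?_)
    rw [norm_mul, hn, mul_one]
  · exact ((Continuous.aestronglyMeasurable (by fun_prop)).mul hf.aestronglyMeasurable).mul
      (Continuous.aestronglyMeasurable (by fun_prop))
  · refine Eventually.of_forall fun x a _ => ?_
    rw [norm_mul, hn, mul_one, norm_mul, norm_mul, Complex.norm_I, one_mul, Complex.norm_real,
      ← mul_assoc]
    gcongr
    exact norm_inner_le_norm _ _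
  · refine Eventually.of_forall fun x a _ => ?_
    have h1 : HasDerivAt (fun a : ℝ => ((inner ℝ (ξ + a • u) x : ℝ) : ℂ)) (inner ℝ u x : ℝ) a := by
      have : HasDerivAt (fun a : ℝ => (inner ℝ (ξ + a • u) x : ℝ)) (inner ℝ u x : ℝ) a := by
        simp only [inner_add_left, real_inner_smul_left]
        simpa using ((hasDerivAt_id a).mul_const (inner ℝ u x : ℝ)).const_add (inner ℝ ξ x : ℝ)
      exact this.ofReal_comp
    convert! ((h1.const_mul Complex.I).cexp).const_mul (f x) using 1
    ring

theorem integral_gaussian_mul_cexp_inner {n : ℕ} {t : ℝ} (ht : 0 < t) (ξ : Euc n) :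
    ∫ x : Euc n, (Real.exp (-t * ‖x‖ ^ 2) : ℂ) * Complex.exp (Complex.I * (inner ℝ ξ x : ℝ)) =
      (Real.pi / t : ℂ) ^ ((n : ℂ) / 2) * (Real.exp (-(‖ξ‖ ^ 2 / (4 * t))) : ℝ) := by
  have h   := GaussianFourier.integral_cexp_neg_mul_sq_norm_add (V := Euc n) (b := t) (by simpa using ht)
    Complex.I ξ
  rw [finrank_euclideanSpace_fin] at h
  convert! h using 3 with x
  · rw [Complex.exp_add]; push_cast; rfl
  · push_cast
    rw [Complex.I_sq]
    congr 1; ring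

theorem hasDerivAt_gaussian_line {n : ℕ} (t : ℝ) (ξ v : Euc n) :
    HasDerivAt (fun a : ℝ => ((Real.exp (-(‖ξ + a • v‖ ^ 2 / (4 * t))) : ℝ) : ℂ))
      (-((inner ℝ ξ v : ℝ) : ℂ) / (2 * t) * (Real.exp (-(‖ξ‖ ^ 2 / (4 * t))) : ℝ)) 0 := by
  have h0 : HasDerivAt (fun a : ℝ => ‖ξ + a • v‖ ^ 2) (2 * inner ℝ ξ v) 0 := by
    have : HasDerivAt (fun a : ℝ => ξ + a • v) v 0 := by
      simpa using ((hasDerivAt_id (0 : ℝ)).smul_const v).const_add ξ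
    simpa using this.norm_sq
  have h1 := ((h0.div_const (4 * t)).neg.exp).ofReal_comp
  convert! h1 using 1
  simp only [Pi.neg_apply, zero_smul, add_zero]
  push_cast
  ring

theorem integral_gaussian_mul_inner_mul_cexp_inner {n : ℕ} (hn : 1 ≤ n) {t : ℝ} (ht : 0 < t)
    (u ξ : Euc n) :
    ∫ x : Euc n, Complex.I * (inner ℝ u x : ℝ) * (Real.exp (-t * ‖x‖ ^ 2) : ℂ) *
        Complex.exp (Complex.I * (inner ℝ ξ x : ℝ)) =
      (Real.pi / t : ℂ) ^ ((n : ℂ) / 2) * (-((inner ℝ ξ u : ℝ) : ℂ) / (2 * t) *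
        (Real.exp (-(‖ξ‖ ^ 2 / (4 * t))) : ℝ)) := by
  have hi := fun k => integrable_norm_pow_mul_exp_neg_mul_sq hn ht k
  have h := hasDerivAt_integral_mul_cexp_inner
    (f := fun x : Euc n => (Real.exp (-t * ‖x‖ ^ 2) : ℂ))
    (by simpa using (hi 0).ofReal (𝕜 := ℂ))
    (by simpa [Complex.norm_real, -Complex.ofReal_exp, -neg_mul] using (hi 1)) u ξ
  simp only [integral_gaussian_mul_cexp_inner ht] at h
  exact h.unique ((hasDerivAt_gaussian_line t ξ u).const_mul _)

theorem integral_gaussian_mul_inner_mul_inner_mul_cexp_inner {n : ℕ} (hn : 1 ≤ n) {t : ℝ}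
    (ht : 0 < t) (u v ξ : Euc n) :
    ∫ x : Euc n, (Real.exp (-t * ‖x‖ ^ 2) : ℂ) * ((inner ℝ u x : ℝ) * (inner ℝ v x : ℝ)) *
        Complex.exp (Complex.I * (inner ℝ ξ x : ℝ)) =
      (Real.pi / t : ℂ) ^ ((n : ℂ) / 2) * (Real.exp (-(‖ξ‖ ^ 2 / (4 * t))) : ℝ) *
        ((inner ℝ u v : ℝ) / (2 * t) - (inner ℝ u ξ : ℝ) * (inner ℝ v ξ : ℝ) / (4 * t ^ 2)) := by
  have hi := fun k => integrable_norm_pow_mul_exp_neg_mul_sq hn ht k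
  have hnorm : ∀ x : Euc n, ‖Complex.I * (inner ℝ u x : ℝ) * (Real.exp (-t * ‖x‖ ^ 2) : ℂ)‖ ≤
      ‖u‖ * (‖x‖ * Real.exp (-t * ‖x‖ ^ 2)) := fun x => by
    rw [norm_mul, norm_mul, Complex.norm_I, one_mul, Complex.norm_real, Complex.norm_real,
      Real.norm_of_nonneg (Real.exp_pos _).le, ← mul_assoc]
    gcongr
    exact norm_inner_le_norm _ _
  have h := hasDerivAt_integral_mul_cexp_inner
    (f := fun x : Euc n => Complex.I * (inner ℝ u x : ℝ) * (Real.exp (-t * ‖x‖ ^ 2) : ℂ)) ?_ ?_ v ξ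
  rotate_left
  · refine ((hi 1).const_mul ‖u‖).mono' (Continuous.aestronglyMeasurable (by fun_prop))
      (Eventually.of_forall fun x => ?_)
    simpa only [pow_one] using hnorm x
  · refine ((hi 2).const_mul ‖u‖).mono' (Continuous.aestronglyMeasurable (by fun_prop))
      (Eventually.of_forall fun x => ?_)
    rw [norm_mul, norm_norm, norm_norm]
    refine (mul_le_mul_of_nonneg_left (hnorm x) (norm_nonneg x)).trans_eq (by ring)
  simp only [integral_gaussian_mul_inner_mul_cexp_inner hn ht] at h
  have h1 : HasDerivAt (fun a : ℝ => ((inner ℝ (ξ + a • v) u : ℝ) : ℂ)) (inner ℝ v u : ℝ) 0 := by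
    have : HasDerivAt (fun a : ℝ => (inner ℝ (ξ + a • v) u : ℝ)) (inner ℝ v u : ℝ) 0 := by
      simp only [inner_add_left, real_inner_smul_left]
      simpa using ((hasDerivAt_id (0 : ℝ)).mul_const (inner ℝ v u : ℝ)).const_add (inner ℝ ξ u : ℝ)
    exact this.ofReal_comp
  have h2 := h.unique ((((h1.neg).div_const (2 * t : ℂ)).mul
    (hasDerivAt_gaussian_line t ξ v)).const_mul _)
  -- The two derivatives give `(i⟨u,x⟩)(i⟨v,x⟩) = -⟨u,x⟩⟨v,x⟩`.
  have h3 : ∀ x : Euc n, (Real.exp (-t * ‖x‖ ^ 2) : ℂ) *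
      ((inner ℝ u x : ℝ) * (inner ℝ v x : ℝ)) * Complex.exp (Complex.I * (inner ℝ ξ x : ℝ)) =
      -(Complex.I * (inner ℝ v x : ℝ) * (Complex.I * (inner ℝ u x : ℝ) *
        (Real.exp (-t * ‖x‖ ^ 2) : ℂ)) * Complex.exp (Complex.I * (inner ℝ ξ x : ℝ))) := fun x => by
    linear_combination ((Real.exp (-t * ‖x‖ ^ 2) : ℂ) *
      ((inner ℝ u x : ℝ) * (inner ℝ v x : ℝ)) * Complex.exp (Complex.I * (inner ℝ ξ x : ℝ))) *
      Complex.I_sq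
  simp only [h3]
  rw [integral_neg, h2]
  simp only [zero_smul, add_zero, real_inner_comm v u, real_inner_comm ξ u, real_inner_comm ξ v,
    Pi.neg_apply]
  ring

/-- Fubini, justified by the unimodular exponential: the transform moves from the Schwartz function
to `g`. -/
theorem integral_mul_schwartzFourier {n : ℕ} {g : Euc n → ℂ} (hg : Integrable g)
    (φ : 𝓢(Euc n, ℂ)) :
    ∫ x, g x * schwartzFourier n φ x =
      ∫ ξ, (∫ x, g x * Complex.exp (Complex.I * (inner ℝ ξ x : ℝ))) * φ ξ := by
  simp only [schwartzFourier_apply, ← integral_const_mul, ← integral_mul_const]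
  rw [integral_integral_swap]
  · refine integral_congr_ae (Eventually.of_forall fun ξ => integral_congr_ae
      (Eventually.of_forall fun x => ?_))
    ring
  · refine (hg.mul_prod φ.integrable).mono ?_ (Eventually.of_forall fun z => ?_)
    · have h1 : AEStronglyMeasurable (fun z : Euc n × Euc n => g z.1)
          (volume.prod volume) := hg.aestronglyMeasurable.comp_fst
      have h2 : Continuous (fun z : Euc n × Euc n =>
          φ z.2 * Complex.exp (Complex.I * (inner ℝ z.2 z.1 : ℝ))) := by
        have := φ.continuous
        fun_prop
      exact h1.mul h2.aestronglyMeasurable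
    · simp only [Function.uncurry, norm_mul]
      rw [mul_comm Complex.I, Complex.norm_exp_ofReal_mul_I, mul_one]

/-! ### Powers of the norm as superpositions of Gaussians. -/

theorem integrable_prod_of_integral_norm_eq {n : ℕ} (hn : 1 ≤ n) {κ : ℝ → ℝ → ℂ}
    (hκ : Measurable (Function.uncurry κ)) {b c : ℝ}
    (hint : ∀ ρ : ℝ, 0 < ρ → IntegrableOn (κ ρ) (Set.Ioi 0))
    (hnorm : ∀ ρ : ℝ, 0 < ρ → ∫ t in Set.Ioi 0, ‖κ ρ t‖ = c * ρ ^ (-b))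
    {h : Euc n → ℂ} (hh : Measurable h)
    (hi : Integrable (fun x => ‖x‖ ^ (-2 * b) * ‖h x‖)) :
    Integrable (fun z : Euc n × ℝ => κ (‖z.1‖ ^ 2) z.2 * h z.1)
      (volume.prod (volume.restrict (Set.Ioi 0))) := by
  have : Nonempty (Fin n) := ⟨⟨0, hn⟩⟩
  have hne : ∀ᵐ x : Euc n, x ≠ 0 := compl_mem_ae_iff.mpr (measure_singleton 0)
  have hm : Measurable (fun z : Euc n × ℝ => κ (‖z.1‖ ^ 2) z.2 * h z.1) := by
    have h1 : Measurable (fun z : Euc n × ℝ => (‖z.1‖ ^ 2, z.2)) := by fun_prop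
    exact (hκ.comp h1).mul (hh.comp measurable_fst)
  rw [integrable_prod_iff hm.aestronglyMeasurable]
  constructor
  · filter_upwards [hne] with x hx
    exact (hint _ (by positivity)).mul_const _
  · refine (hi.const_mul c).congr ?_
    filter_upwards [hne] with x hx
    have hx' : 0 < ‖x‖ := norm_pos_iff.mpr hx
    simp only [norm_mul]
    rw [integral_mul_const, hnorm _ (by positivity), ← Real.rpow_natCast, ← Real.rpow_mul hx'.le,
      mul_assoc]
    congr 3
    push_cast; ring

/-- A non-integrable function has integral `0` by convention, so a positive integral of the norm
already proves integrability. -/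
theorem integrableOn_of_integral_norm_pos {κ : ℝ → ℂ} (hκ : Measurable κ)
    (h : 0 < ∫ t in Set.Ioi 0, ‖κ t‖) : IntegrableOn κ (Set.Ioi 0) := by
  rw [IntegrableOn, ← integrable_norm_iff hκ.aestronglyMeasurable]
  exact not_imp_comm.mp integral_undef h.ne'

/-- The integrand `t^{a-1} e^{-ρt}` of the Gamma integral. -/
def gammaKernel (a : ℂ) (ρ t : ℝ) : ℂ := (t : ℂ) ^ (a - 1) * Complex.exp (-(ρ * t))

/-- The integrand `t^{-a-1} e^{-ρ/4t}` of the inverted Gamma integral. -/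
def invGammaKernel (a : ℂ) (ρ t : ℝ) : ℂ :=
  (t : ℂ) ^ (-a - 1) * Complex.exp (-((ρ / 4 : ℝ) * (t⁻¹ : ℝ)))

theorem measurable_gammaKernel (a : ℂ) : Measurable (Function.uncurry (gammaKernel a)) := by
  unfold gammaKernel Function.uncurry
  fun_prop

theorem measurable_invGammaKernel (a : ℂ) : Measurable (Function.uncurry (invGammaKernel a)) := by
  unfold invGammaKernel Function.uncurry
  fun_prop

theorem integral_gammaKernel {a : ℂ} (ha : 0 < a.re) {ρ : ℝ} (hρ : 0 < ρ) :
    ∫ t in Set.Ioi 0, gammaKernel a ρ t = (ρ : ℂ) ^ (-a) * Complex.Gamma a := by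
  have h := Complex.integral_cpow_mul_exp_neg_mul_Ioi ha hρ
  rw [one_div, Complex.inv_cpow _ _ (by
    rw [Complex.arg_ofReal_of_nonneg hρ.le]; exact Real.pi_pos.ne), ← Complex.cpow_neg] at h
  exact h

/-- The substitution `t ↦ 1/t` reduces this to the Gamma integral with `ρ/4`. -/
theorem integral_invGammaKernel {a : ℂ} (ha : 0 < a.re) {ρ : ℝ} (hρ : 0 < ρ) :
    ∫ t in Set.Ioi 0, invGammaKernel a ρ t =
      ((ρ / 4 : ℝ) : ℂ) ^ (-a) * Complex.Gamma a := by
  have h := mellin_comp_inv (fun t : ℝ => Complex.exp (-((ρ / 4 : ℝ) * (t : ℝ)))) (-a)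
  rw [neg_neg] at h
  rw [← integral_gammaKernel ha (show 0 < ρ / 4 by positivity)]
  exact h

/-- The modulus is the same kernel with parameter `Re a`, so absolute integrals come from the same
Gamma formula. -/
theorem norm_gammaKernel (a : ℂ) (ρ : ℝ) {t : ℝ} (ht : 0 < t) :
    (‖gammaKernel a ρ t‖ : ℂ) = gammaKernel (a.re : ℂ) ρ t := by
  rw [gammaKernel, gammaKernel, norm_mul, Complex.norm_cpow_eq_rpow_re_of_pos ht, Complex.norm_exp]
  push_cast [Complex.ofReal_cpow ht.le]
  simp

theorem norm_invGammaKernel (a : ℂ) (ρ : ℝ) {t : ℝ} (ht : 0 < t) :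
    (‖invGammaKernel a ρ t‖ : ℂ) = invGammaKernel (a.re : ℂ) ρ t := by
  rw [invGammaKernel, invGammaKernel, norm_mul, Complex.norm_cpow_eq_rpow_re_of_pos ht,
    ← Complex.ofReal_mul, ← Complex.ofReal_neg, Complex.norm_exp_ofReal]
  push_cast [Complex.ofReal_cpow ht.le]
  simp

theorem integral_norm_gammaKernel {a : ℂ} (ha : 0 < a.re) {ρ : ℝ} (hρ : 0 < ρ) :
    ∫ t in Set.Ioi 0, ‖gammaKernel a ρ t‖ = Real.Gamma a.re * ρ ^ (-a.re) := by
  apply Complex.ofReal_injective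
  rw [← integral_complex_ofReal, setIntegral_congr_fun measurableSet_Ioi
    (fun t ht => norm_gammaKernel a ρ ht), integral_gammaKernel (by simpa using ha) hρ,
    Complex.Gamma_ofReal, Complex.ofReal_mul, Complex.ofReal_cpow hρ.le, mul_comm]
  simp

theorem integral_norm_invGammaKernel {a : ℂ} (ha : 0 < a.re) {ρ : ℝ} (hρ : 0 < ρ) :
    ∫ t in Set.Ioi 0, ‖invGammaKernel a ρ t‖ =
      (Real.Gamma a.re * (1 / 4) ^ (-a.re)) * ρ ^ (-a.re) := by
  apply Complex.ofReal_injective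
  rw [← integral_complex_ofReal, setIntegral_congr_fun measurableSet_Ioi
    (fun t ht => norm_invGammaKernel a ρ ht), integral_invGammaKernel (by simpa using ha) hρ,
    Complex.Gamma_ofReal, mul_assoc, ← Real.mul_rpow (by norm_num) hρ.le, Complex.ofReal_mul,
    Complex.ofReal_cpow (by positivity), mul_comm, one_div_mul_eq_div]
  simp

theorem integrable_gammaKernel_prod {n : ℕ} (hn : 1 ≤ n) {a : ℂ} (ha : 0 < a.re) {h : Euc n → ℂ}
    (hh : Measurable h) (hi : Integrable (fun x => ‖x‖ ^ (-2 * a.re) * ‖h x‖)) :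
    Integrable (fun z : Euc n × ℝ => gammaKernel a (‖z.1‖ ^ 2) z.2 * h z.1)
      (volume.prod (volume.restrict (Set.Ioi 0))) := by
  refine integrable_prod_of_integral_norm_eq hn (measurable_gammaKernel a) (fun ρ hρ => ?_)
    (fun ρ hρ => integral_norm_gammaKernel ha hρ) hh hi
  refine integrableOn_of_integral_norm_pos
    ((measurable_gammaKernel a).comp measurable_prodMk_left) ?_
  have := Real.Gamma_pos_of_pos ha
  exact lt_of_lt_of_eq (by positivity) (integral_norm_gammaKernel ha hρ).symm

theorem integrable_invGammaKernel_prod {n : ℕ} (hn : 1 ≤ n) {a : ℂ} (ha : 0 < a.re)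
    {h : Euc n → ℂ} (hh : Measurable h)
    (hi : Integrable (fun x => ‖x‖ ^ (-2 * a.re) * ‖h x‖)) :
    Integrable (fun z : Euc n × ℝ => invGammaKernel a (‖z.1‖ ^ 2) z.2 * h z.1)
      (volume.prod (volume.restrict (Set.Ioi 0))) := by
  refine integrable_prod_of_integral_norm_eq hn (measurable_invGammaKernel a) (fun ρ hρ => ?_)
    (fun ρ hρ => integral_norm_invGammaKernel ha hρ) hh hi
  refine integrableOn_of_integral_norm_pos
    ((measurable_invGammaKernel a).comp measurable_prodMk_left) ?_
  have := Real.Gamma_pos_of_pos ha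
  exact lt_of_lt_of_eq (by positivity) (integral_norm_invGammaKernel ha hρ).symm

theorem integral_integral_gammaKernel {n : ℕ} (hn : 1 ≤ n) {a : ℂ} (ha : 0 < a.re)
    {h : Euc n → ℂ} (hh : Measurable h)
    (hi : Integrable (fun x => ‖x‖ ^ (-2 * a.re) * ‖h x‖)) :
    ∫ t in Set.Ioi (0 : ℝ), ∫ x, gammaKernel a (‖x‖ ^ 2) t * h x =
      Complex.Gamma a * ∫ x, (‖x‖ : ℂ) ^ (-2 * a) * h x := by
  have : Nonempty (Fin n) := ⟨⟨0, hn⟩⟩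
  have hne : ∀ᵐ x : Euc n, x ≠ 0 := compl_mem_ae_iff.mpr (measure_singleton 0)
  rw [← integral_integral_swap (integrable_gammaKernel_prod hn ha hh hi), ← integral_const_mul]
  refine integral_congr_ae ?_
  filter_upwards [hne] with x hx
  have hx' : 0 < ‖x‖ := norm_pos_iff.mpr hx
  rw [integral_mul_const, integral_gammaKernel ha (by positivity), Complex.ofReal_pow, pow_two,
    Complex.mul_cpow_ofReal_nonneg hx'.le hx'.le,
    ← Complex.cpow_add _ _ (Complex.ofReal_ne_zero.mpr hx'.ne')]
  ring_nf

theorem integral_integral_invGammaKernel {n : ℕ} (hn : 1 ≤ n) {a : ℂ} (ha : 0 < a.re)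
    {h : Euc n → ℂ} (hh : Measurable h)
    (hi : Integrable (fun x => ‖x‖ ^ (-2 * a.re) * ‖h x‖)) :
    ∫ t in Set.Ioi (0 : ℝ), ∫ x, invGammaKernel a (‖x‖ ^ 2) t * h x =
      2 ^ (2 * a) * Complex.Gamma a * ∫ x, (‖x‖ : ℂ) ^ (-2 * a) * h x := by
  have : Nonempty (Fin n) := ⟨⟨0, hn⟩⟩
  have hne : ∀ᵐ x : Euc n, x ≠ 0 := compl_mem_ae_iff.mpr (measure_singleton 0)
  rw [← integral_integral_swap (integrable_invGammaKernel_prod hn ha hh hi), ← integral_const_mul]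
  refine integral_congr_ae ?_
  filter_upwards [hne] with x hx
  have hx' : 0 < ‖x‖ := norm_pos_iff.mpr hx
  have h2 : ((2 : ℝ) : ℂ) ≠ 0 := by norm_num
  have e : ((‖x‖ ^ 2 / 4 : ℝ) : ℂ) ^ (-a) = (2 : ℂ) ^ (2 * a) * (‖x‖ : ℂ) ^ (-2 * a) := by
    rw [show ‖x‖ ^ 2 / 4 = (‖x‖ / 2) * (‖x‖ / 2) by ring, Complex.ofReal_mul,
      Complex.mul_cpow_ofReal_nonneg (by positivity) (by positivity), div_eq_mul_inv,
      Complex.ofReal_mul, Complex.mul_cpow_ofReal_nonneg (by positivity) (by positivity),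
      Complex.ofReal_inv, Complex.inv_cpow _ _ (by
        rw [Complex.arg_ofReal_of_nonneg zero_le_two]; exact Real.pi_pos.ne), ← Complex.cpow_neg,
      neg_neg, mul_mul_mul_comm,
      ← Complex.cpow_add _ _ (Complex.ofReal_ne_zero.mpr hx'.ne'), ← Complex.cpow_add _ _ h2]
    rw [mul_comm, Complex.ofReal_ofNat]
    ring_nf
  rw [integral_mul_const, integral_invGammaKernel ha (by positivity), e]
  ring

/-! ### The transform of the scalar kernels in the strip `-n < Re s < 0`. -/

theorem integrable_norm_rpow_mul_norm_inner_mul {n : ℕ} (hn : 1 ≤ n) (u v : Euc n) {σ : ℝ}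
    (hσ : -(n : ℝ) < σ) (φ : 𝓢(Euc n, ℂ)) :
    Integrable (fun x : Euc n => ‖x‖ ^ (σ - 2) *
      ‖((inner ℝ u x : ℝ) * (inner ℝ v x : ℝ) : ℂ) * φ x‖) := by
  have : Nonempty (Fin n) := ⟨⟨0, hn⟩⟩
  have hne : ∀ᵐ x : Euc n, x ≠ 0 := compl_mem_ae_iff.mpr (measure_singleton 0)
  refine (integrable_pairKernel_mul hn u v (s := σ) (by simpa using hσ) φ).norm.congr ?_
  filter_upwards [hne] with x hx
  have hx' : 0 < ‖x‖ := norm_pos_iff.mpr hx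
  rw [pairKernel, mul_assoc, norm_mul, Complex.norm_cpow_eq_rpow_re_of_pos hx']
  simp

/-- With `a = 1 - s/2`, integration over `t` will recover `|x|^{-2a} = |x|^{s-2}`. The Gaussian
transform contributes `t^{-n/2}` times `t^{-1}` or `t^{-2}`, whence the parameters `(s+n)/2` and
`(s+n)/2 + 1` on the right. -/
theorem integral_gammaKernel_mul_schwartzFourier {n : ℕ} (hn : 1 ≤ n) (u v : Euc n) (s : ℂ)
    {t : ℝ} (ht : 0 < t) (φ : 𝓢(Euc n, ℂ)) :
    ∫ x : Euc n, gammaKernel (1 - s / 2) (‖x‖ ^ 2) t *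
        (((inner ℝ u x : ℝ) * (inner ℝ v x : ℝ) : ℂ) * schwartzFourier n φ x) =
      ∫ x : Euc n, ((Real.pi : ℂ) ^ ((n : ℂ) / 2) / 2 * (inner ℝ u v : ℝ) *
          (invGammaKernel ((s + n) / 2) (‖x‖ ^ 2) t * φ x) -
        (Real.pi : ℂ) ^ ((n : ℂ) / 2) / 4 * (invGammaKernel ((s + n) / 2 + 1) (‖x‖ ^ 2) t *
          (((inner ℝ u x : ℝ) * (inner ℝ v x : ℝ) : ℂ) * φ x))) := by
  have ht0 : (t : ℂ) ≠ 0 := Complex.ofReal_ne_zero.mpr ht.ne'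
  have hg : Integrable (fun x : Euc n => (Real.exp (-t * ‖x‖ ^ 2) : ℂ) *
      ((inner ℝ u x : ℝ) * (inner ℝ v x : ℝ))) := by
    refine ((integrable_norm_pow_mul_exp_neg_mul_sq hn ht 2).const_mul (‖u‖ * ‖v‖)).mono'
      (Continuous.aestronglyMeasurable (by fun_prop)) (Eventually.of_forall fun x => ?_)
    rw [norm_mul, norm_mul, Complex.norm_real, Complex.norm_real, Complex.norm_real,
      Real.norm_of_nonneg (Real.exp_pos _).le]
    calc _ ≤ Real.exp (-t * ‖x‖ ^ 2) * ((‖u‖ * ‖x‖) * (‖v‖ * ‖x‖)) := by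
          gcongr <;> exact norm_inner_le_norm _ _
      _ = _ := by ring
  have h1 : ∀ x : Euc n, gammaKernel (1 - s / 2) (‖x‖ ^ 2) t *
      (((inner ℝ u x : ℝ) * (inner ℝ v x : ℝ) : ℂ) * schwartzFourier n φ x) =
      (t : ℂ) ^ (-s / 2) * ((Real.exp (-t * ‖x‖ ^ 2) : ℂ) *
      ((inner ℝ u x : ℝ) * (inner ℝ v x : ℝ)) * schwartzFourier n φ x) := fun x => by
    rw [gammaKernel, show 1 - s / 2 - 1 = -s / 2 by ring]
    push_cast
    rw [show -((‖x‖ : ℂ) ^ 2 * t) = -(t : ℂ) * ‖x‖ ^ 2 by ring]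
    ring
  simp only [h1]
  rw [integral_const_mul, integral_mul_schwartzFourier hg, ← integral_const_mul]
  refine integral_congr_ae (Eventually.of_forall fun ξ => ?_)
  simp only
  rw [integral_gaussian_mul_inner_mul_inner_mul_cexp_inner hn ht, invGammaKernel, invGammaKernel]
  have e1 : (Real.pi / t : ℂ) ^ ((n : ℂ) / 2) =
      (Real.pi : ℂ) ^ ((n : ℂ) / 2) * (t : ℂ) ^ (-((n : ℂ) / 2)) := by
    rw [div_eq_mul_inv, ← Complex.ofReal_inv, Complex.mul_cpow_ofReal_nonneg Real.pi_pos.le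
      (inv_nonneg.mpr ht.le), Complex.ofReal_inv, Complex.inv_cpow _ _ (by
        rw [Complex.arg_ofReal_of_nonneg ht.le]; exact Real.pi_pos.ne), ← Complex.cpow_neg]
  have e2 : (t : ℂ) ^ (-((s + n) / 2) - 1) =
      (t : ℂ) ^ (-s / 2) * (t : ℂ) ^ (-((n : ℂ) / 2)) * (t : ℂ)⁻¹ := by
    rw [← Complex.cpow_neg_one, ← Complex.cpow_add _ _ ht0, ← Complex.cpow_add _ _ ht0]
    congr 1; ring
  have e3 : (t : ℂ) ^ (-((s + n) / 2 + 1) - 1) =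
      (t : ℂ) ^ (-s / 2) * (t : ℂ) ^ (-((n : ℂ) / 2)) * ((t : ℂ)⁻¹ * (t : ℂ)⁻¹) := by
    rw [← Complex.cpow_neg_one, ← Complex.cpow_add _ _ ht0, ← Complex.cpow_add _ _ ht0,
      ← Complex.cpow_add _ _ ht0]
    congr 1; ring
  have e4 : ((Real.exp (-(‖ξ‖ ^ 2 / (4 * t))) : ℝ) : ℂ) =
      Complex.exp (-((‖ξ‖ ^ 2 / 4 : ℝ) * (t⁻¹ : ℝ))) := by
    rw [Complex.ofReal_exp]
    congr 1
    push_cast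
    field_simp
  rw [e1, e2, e3, e4]
  field_simp

/-- The lower bound on `Re s` makes `|x|^s` locally integrable, the upper bound does the same for
`|x|^{-s-n}`. The factor `s + n` comes from `Γ(z+1) = zΓ(z)` at `z = (s+n)/2`. -/
theorem integral_pairKernel_mul_schwartzFourier {n : ℕ} (hn : 1 ≤ n) (u v : Euc n) {s : ℂ}
    (hs : -(n : ℝ) < s.re) (hs' : s.re < 0) (φ : 𝓢(Euc n, ℂ)) :
    Complex.Gamma (1 - s / 2) * ∫ x, pairKernel u v s x * schwartzFourier n φ x =
      (Real.pi : ℂ) ^ ((n : ℂ) / 2) * 2 ^ (s + n - 1) * Complex.Gamma ((s + n) / 2) *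
        ((inner ℝ u v : ℝ) * (∫ x : Euc n, (‖x‖ : ℂ) ^ (-s - n) * φ x) -
          (s + n) * ∫ x, pairKernel u v (-s - n) x * φ x) := by
  have hre1 : (1 - s / 2).re = 1 - s.re / 2 := by simp
  have hre2 : ((s + n) / 2).re = (s.re + n) / 2 := by simp
  have hre3 : ((s + n) / 2 + 1).re = (s.re + n) / 2 + 1 := by simp
  have ha1 : 0 < (1 - s / 2).re := by rw [hre1]; linarith
  have ha2 : 0 < ((s + n) / 2).re := by rw [hre2]; linarith
  have ha3 : 0 < ((s + n) / 2 + 1).re := by rw [hre3]; linarith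
  have hsn0 : (s + n) / 2 ≠ 0 := fun h => by rw [h] at ha2; simp at ha2
  have hm : ∀ ψ : 𝓢(Euc n, ℂ), Measurable
      (fun x => ((inner ℝ u x : ℝ) * (inner ℝ v x : ℝ) : ℂ) * ψ x) := fun ψ => by
    have h1 : Measurable (fun x : Euc n => ((inner ℝ u x : ℝ) * (inner ℝ v x : ℝ) : ℂ)) := by
      fun_prop
    exact h1.mul ψ.continuous.measurable
  have hi1 := integrable_norm_rpow_mul_norm_inner_mul hn u v hs (schwartzFourier n φ)
  have hi2 := SchwartzMap.integrable_norm_rpow_mul_norm hn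
    (show -(n : ℝ) < -(s.re + n) by linarith) φ
  have hi3 := integrable_norm_rpow_mul_norm_inner_mul hn u v
    (show -(n : ℝ) < -(s.re + n) by linarith) φ
  rw [show s.re - 2 = -2 * (1 - s / 2).re by rw [hre1]; ring] at hi1
  rw [show -(s.re + n) = -2 * ((s + n) / 2).re by rw [hre2]; ring] at hi2
  rw [show -(s.re + n) - 2 = -2 * ((s + n) / 2 + 1).re by rw [hre3]; ring] at hi3
  have hG1 := integral_integral_gammaKernel hn ha1 (hm _) hi1
  have hG2 := integral_integral_invGammaKernel hn ha2 φ.continuous.measurable hi2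
  have hG3 := integral_integral_invGammaKernel hn ha3 (hm _) hi3
  have hP2 := integrable_invGammaKernel_prod hn ha2 φ.continuous.measurable hi2
  have hP3 := integrable_invGammaKernel_prod hn ha3 (hm _) hi3
  have hsplit : ∫ t in Set.Ioi (0 : ℝ), ∫ x : Euc n, gammaKernel (1 - s / 2) (‖x‖ ^ 2) t *
        (((inner ℝ u x : ℝ) * (inner ℝ v x : ℝ) : ℂ) * schwartzFourier n φ x) =
      (Real.pi : ℂ) ^ ((n : ℂ) / 2) / 2 * (inner ℝ u v : ℝ) *
        (∫ t in Set.Ioi (0 : ℝ), ∫ x, invGammaKernel ((s + n) / 2) (‖x‖ ^ 2) t * φ x) -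
      (Real.pi : ℂ) ^ ((n : ℂ) / 2) / 4 *
        (∫ t in Set.Ioi (0 : ℝ), ∫ x, invGammaKernel ((s + n) / 2 + 1) (‖x‖ ^ 2) t *
          (((inner ℝ u x : ℝ) * (inner ℝ v x : ℝ) : ℂ) * φ x)) := by
    rw [← integral_const_mul, ← integral_const_mul, ← integral_sub
      (hP2.integral_prod_right.const_mul _) (hP3.integral_prod_right.const_mul _)]
    refine integral_congr_ae ?_
    filter_upwards [ae_restrict_mem measurableSet_Ioi, hP2.prod_left_ae, hP3.prod_left_ae]
      with t ht h2 h3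
    rw [integral_gammaKernel_mul_schwartzFourier hn u v s ht φ,
      integral_sub (h2.const_mul _) (h3.const_mul _), integral_const_mul, integral_const_mul]
  rw [hG1, hG2, hG3, Complex.Gamma_add_one _ hsn0] at hsplit
  have hK : ∀ (s : ℂ) (ψ : 𝓢(Euc n, ℂ)), ∫ x, pairKernel u v s x * ψ x =
      ∫ x : Euc n, (‖x‖ : ℂ) ^ (s - 2) *
        (((inner ℝ u x : ℝ) * (inner ℝ v x : ℝ) : ℂ) * ψ x) := fun s ψ => by
    simp only [pairKernel, mul_assoc]
  rw [hK, hK, show s - 2 = -2 * (1 - s / 2) by ring, hsplit,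
    show -s - (n : ℂ) - 2 = -2 * ((s + n) / 2 + 1) by ring,
    show -s - (n : ℂ) = -2 * ((s + n) / 2) by ring,
    show 2 * ((s + n) / 2) = (s + n - 1) + 1 by ring,
    show 2 * ((s + n) / 2 + 1) = (s + n - 1) + 3 by ring,
    Complex.cpow_add _ _ two_ne_zero, Complex.cpow_add _ _ two_ne_zero, Complex.cpow_one,
    show (2 : ℂ) ^ (3 : ℂ) = 8 by norm_num]
  ring

/-! ### Exterior algebra: the anticommutation relation and the trace of `ε_j i_k`. -/

/-- A form, as an alternating map. -/
def FormSpace.toAlt {n p : ℕ} (ω : FormSpace n p) : Euc n [⋀^Fin p]→L[ℝ] ℂ := ω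

/-- The value of a form on a tuple of vectors, as a linear map in the form. -/
def FormSpace.eval {n p : ℕ} (v : Fin p → Euc n) : FormSpace n p →ₗ[ℂ] ℂ where
  toFun ω := ω.toAlt v
  map_add' _ _ := rfl
  map_smul' _ _ := rfl

theorem FormSpace.ext_eval {n p : ℕ} {ω η : FormSpace n p}
    (h : ∀ v, FormSpace.eval v ω = FormSpace.eval v η) : ω = η :=
  ContinuousAlternatingMap.ext (f := ω.toAlt) (g := η.toAlt) h

theorem FormEnd.ext_eval {n p : ℕ} {S T : FormEnd n p}
    (h : ∀ ω v, FormSpace.eval v (S ω) = FormSpace.eval v (T ω)) : S = T :=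
  ContinuousLinearMap.ext fun ω => FormSpace.ext_eval (h ω)

theorem FormSpace.eval_cons_sum {n p : ℕ} (ω : FormSpace n (p + 1)) {ι : Type*} (s : Finset ι)
    (c : ι → ℝ) (w : ι → Euc n) (v : Fin p → Euc n) :
    FormSpace.eval (Fin.cons (∑ i ∈ s, c i • w i) v) ω =
      ∑ i ∈ s, (c i : ℂ) * FormSpace.eval (Fin.cons (w i) v) ω := by
  have h : ∀ x, FormSpace.eval (Fin.cons x v : Fin (p + 1) → Euc n) ω =
      ω.toAlt.curryLeft x v := fun _ => rfl
  simp only [h, map_sum, map_smul]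
  rw [ContinuousAlternatingMap.sum_apply]
  simp

theorem eval_exteriorProd {n p : ℕ} (x : Euc n) (ω : FormSpace n p) (v : Fin (p + 1) → Euc n) :
    FormSpace.eval v (exteriorProd n p x ω) = ∑ i : Fin (p + 1),
      (-1) ^ (i : ℕ) * ((inner ℝ x (v i) : ℝ) : ℂ) * FormSpace.eval (i.removeNth v) ω :=
  exteriorAlt_apply x ω v

/-- The polarization `ε_u i_w` of `ε_x i_x`, on `p`-forms. -/
def extIntPair (n : ℕ) : (p : ℕ) → Euc n → Euc n → FormEnd n p
  | 0, _, _ => 0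
  | q + 1, u, w => (exteriorProd n q u).comp (interiorProd n q w)

theorem extInt_eq_extIntPair (n p : ℕ) (x : Euc n) : extInt n p x = extIntPair n p x x := by
  cases p <;> rfl

theorem eval_extIntPair {n p : ℕ} (u w : Euc n) (ω : FormSpace n (p + 1))
    (v : Fin (p + 1) → Euc n) :
    FormSpace.eval v (extIntPair n (p + 1) u w ω) = ∑ i : Fin (p + 1),
      (-1) ^ (i : ℕ) * ((inner ℝ u (v i) : ℝ) : ℂ) *
        FormSpace.eval (Fin.cons w (i.removeNth v)) ω :=
  eval_exteriorProd u _ v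

/-- In the expansion of `x ∧ ω` on `(x, v)`, the slot of `x` gives `|x|² ω(v)`. Every other slot is
shifted by one, hence has the opposite sign, and cancels the matching term of `ε_x i_x`. -/
theorem intExt_add_extInt (n p : ℕ) (x : Euc n) :
    intExt n p x + extInt n p x = ((‖x‖ : ℂ) ^ 2) • (1 : FormEnd n p) := by
  refine FormEnd.ext_eval fun ω v => ?_
  have h : FormSpace.eval v (intExt n p x ω) = FormSpace.eval (Fin.cons x v)
    (exteriorProd n p x ω) := rfl
  rw [add_apply, map_add, h, eval_exteriorProd, Fin.sum_univ_succ]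
  cases p with
  | zero => simp [extInt]
  | succ q =>
    rw [extInt_eq_extIntPair, eval_extIntPair, add_assoc, ← Finset.sum_add_distrib,
      Finset.sum_eq_zero]
    · simp
    · intro i _
      have : (i.succ).removeNth (Fin.cons x v : Fin (q + 2) → Euc n) =
          Fin.cons x (i.removeNth v) := by
        ext k : 1
        refine Fin.cases ?_ (fun k => ?_) k <;> simp [Fin.removeNth]
      rw [this]
      simp only [Fin.val_succ, Fin.cons_succ]
      ring

/-- The standard basis vectors of `ℝⁿ`. -/
abbrev Euc.basisVec {n : ℕ} (j : Fin n) : Euc n := EuclideanSpace.single j (1 : ℝ)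

theorem Euc.sum_smul_basisVec {n : ℕ} (x : Euc n) : ∑ j, x j • Euc.basisVec j = x := by
  ext k
  simp [Euc.basisVec, Pi.single_apply]

theorem extInt_eq_sum (n p : ℕ) (x : Euc n) :
    extInt n p x = ∑ j, ∑ k, ((x j : ℂ) * (x k : ℂ)) •
      extIntPair n p (Euc.basisVec j) (Euc.basisVec k) := by
  cases p with
  | zero => simp [extInt, extIntPair]
  | succ q =>
    refine FormEnd.ext_eval fun ω v => ?_
    simp only [sum_apply, smul_apply, map_sum, map_smul,
      extInt_eq_extIntPair, eval_extIntPair, smul_eq_mul, Finset.mul_sum]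
    have h1 : ∀ i, ((inner ℝ x (v i) : ℝ) : ℂ) =
        ∑ j, (x j : ℂ) * (inner ℝ (Euc.basisVec j) (v i) : ℝ) := fun i => by
      conv_lhs => rw [← Euc.sum_smul_basisVec x]
      simp only [sum_inner, real_inner_smul_left]
      push_cast; rfl
    have h2 : ∀ i : Fin (q + 1), FormSpace.eval (Fin.cons x (i.removeNth v)) ω =
        ∑ k, (x k : ℂ) * FormSpace.eval (Fin.cons (Euc.basisVec k) (i.removeNth v)) ω := fun i => by
      rw [← FormSpace.eval_cons_sum, Euc.sum_smul_basisVec]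
    simp only [h1, h2]
    calc _ = ∑ i : Fin (q + 1), ∑ j, ∑ k, (x j : ℂ) * (x k : ℂ) * ((-1) ^ (i : ℕ) *
          ((inner ℝ (Euc.basisVec j) (v i) : ℝ) : ℂ) *
          FormSpace.eval (Fin.cons (Euc.basisVec k) (i.removeNth v)) ω) := by
          refine Finset.sum_congr rfl fun i _ => ?_
          rw [mul_assoc, Finset.sum_mul_sum, Finset.mul_sum]
          refine Finset.sum_congr rfl fun j _ => ?_
          rw [Finset.mul_sum]
          refine Finset.sum_congr rfl fun k _ => ?_
          ring
      _ = _ := by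
          rw [Finset.sum_comm]
          refine Finset.sum_congr rfl fun j _ => ?_
          rw [Finset.sum_comm]

/-- For each slot `i`, summing over the basis puts `v i` back at the front of `ω`; moving it to its
place costs `(-1)^i`, which cancels the existing sign. Each of the `p` slots thus returns `ω(v)`. -/
theorem sum_extIntPair_basisVec (n p : ℕ) :
    ∑ j, extIntPair n p (Euc.basisVec j) (Euc.basisVec j) = (p : ℂ) • (1 : FormEnd n p) := by
  cases p with
  | zero => simp [extIntPair]
  | succ q =>
    refine FormEnd.ext_eval fun ω v => ?_
    simp only [sum_apply, map_sum, eval_extIntPair]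
    rw [Finset.sum_comm]
    have h : ∀ i : Fin (q + 1), ∑ j, (-1 : ℂ) ^ (i : ℕ) *
        ((inner ℝ (Euc.basisVec j) (v i) : ℝ) : ℂ) *
        FormSpace.eval (Fin.cons (Euc.basisVec j) (i.removeNth v)) ω = FormSpace.eval v ω := by
      intro i
      have h1 := FormSpace.eval_cons_sum ω Finset.univ (fun j => v i j) Euc.basisVec (i.removeNth v)
      rw [Euc.sum_smul_basisVec] at h1
      have h2 := ContinuousAlternatingMap.neg_one_pow_smul_map_insertNth
        ω.toAlt i (v i) (i.removeNth v)
      rw [Fin.insertNth_removeNth, Function.update_eq_self] at h2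
      have h3 : FormSpace.eval (Fin.cons (v i) (i.removeNth v)) ω =
          (-1) ^ (i : ℕ) * FormSpace.eval v ω := by
        refine Eq.trans h2.symm ?_
        rw [zsmul_eq_mul]
        push_cast
        rfl
      rw [h3] at h1
      simp only [mul_assoc, ← Finset.mul_sum]
      have h4 : ∀ j, (inner ℝ (Euc.basisVec j) (v i) : ℝ) = v i j := fun j => by
        simp [Euc.basisVec, EuclideanSpace.inner_single_left]
      simp only [h4]
      rw [← h1, ← mul_assoc, ← mul_pow]
      simp
    simp only [h]
    simp

/-! ### From scalar kernels to the Riesz kernel in the strip. -/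

theorem smul_add_sum_smul_eq_sum {ι V : Type*} [Fintype ι] [DecidableEq ι] [AddCommGroup V]
    [Module ℂ V] (r a d q : ℂ) (I : V) (P : ι → ι → V) (x : ι → ℂ) (hq : ∑ j, x j * x j = q) :
    r • ((a * q) • I + d • ∑ j, ∑ k, (x j * x k) • P j k) =
      ∑ j, ∑ k, (r * (x j * x k)) • ((if j = k then a else 0) • I + d • P j k) := by
  have h1 : ∑ j, ∑ k, (r * (x j * x k)) • ((if j = k then a else 0) • I) = (r * (a * q)) • I := by
    simp only [ite_smul, zero_smul, smul_ite, smul_zero, Finset.sum_ite_eq, Finset.mem_univ,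
      if_true, smul_smul]
    rw [← Finset.sum_smul, ← hq, Finset.mul_sum, Finset.mul_sum]
    congr 1
    exact Finset.sum_congr rfl fun j _ => by ring
  rw [smul_add, smul_smul, ← h1]
  simp only [smul_add, Finset.sum_add_distrib, Finset.smul_sum, smul_smul]
  congr 1
  exact Finset.sum_congr rfl fun j _ => Finset.sum_congr rfl fun k _ => by
    rw [mul_right_comm, mul_assoc, mul_comm d, mul_assoc]

/-- Contracting `δ_{jk} tr T` with `N` gives `(tr T)(tr N)`, symmetric in the two: the trace term
passes from the scalars `T` to the coefficients, where it is `γ` times the identity. -/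
theorem sum_smul_sub_trace_smul {ι V : Type*} [Fintype ι] [DecidableEq ι] [AddCommGroup V]
    [Module ℂ V] (T : ι → ι → ℂ) (N N' : ι → ι → V) (I : V) (c σ γ : ℂ)
    (hN : ∑ j, N j j = γ • I)
    (hN' : ∀ j k, N' j k = σ • N j k - (if j = k then γ else 0) • I) :
    ∑ j, ∑ k, (-c * ((if j = k then 1 else 0) * (∑ l, T l l) - σ * T j k)) • N j k =
      c • ∑ j, ∑ k, T j k • N' j k := by
  have h1 : ∑ j, ∑ k, ((if j = k then 1 else 0) * (∑ l, T l l)) • N j k =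
      ((∑ l, T l l) * γ) • I := by
    simp only [ite_mul, one_mul, zero_mul, ite_smul, zero_smul, Finset.sum_ite_eq,
      Finset.mem_univ, if_true]
    rw [← Finset.smul_sum, hN, smul_smul]
  have h2 : ∑ j, ∑ k, T j k • ((if j = k then γ else 0) • I) = ((∑ l, T l l) * γ) • I := by
    simp only [ite_smul, zero_smul, smul_ite, smul_zero, Finset.sum_ite_eq, Finset.mem_univ,
      if_true, smul_smul]
    rw [← Finset.sum_smul, Finset.sum_mul]
  have h3 : ∑ j, ∑ k, (σ * T j k) • N j k = ∑ j, ∑ k, T j k • (σ • N j k) :=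
    Finset.sum_congr rfl fun j _ => Finset.sum_congr rfl fun k _ => by
      rw [smul_smul, mul_comm]
  simp only [hN', smul_sub, Finset.sum_sub_distrib, h2, mul_smul (-c), ← Finset.smul_sum, sub_smul,
    h1, h3]
  module

theorem ite_smul_add_smul_eq_smul_sub {V : Type*} [AddCommGroup V] [Module ℂ V] {q : Prop}
    [Decidable q] {a a' d d' σ γ : ℂ} (I P : V) (ha : a' = σ * a - γ) (hd : d' = σ * d) :
    (if q then a' else 0) • I + d' • P =
      σ • ((if q then a else 0) • I + d • P) - (if q then γ else 0) • I := by
  subst ha hd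
  split_ifs <;> module

theorem integrable_sum_smul_const {ι E V : Type*} [Fintype ι] [MeasurableSpace E] {μ : Measure E}
    [NormedAddCommGroup V] [NormedSpace ℂ V] {f : ι → ι → E → ℂ}
    (hf : ∀ j k, Integrable (f j k) μ) (N : ι → ι → V) :
    Integrable (fun x => ∑ j, ∑ k, f j k x • N j k) μ :=
  integrable_finsetSum _ fun j _ => integrable_finsetSum _ fun k _ => (hf j k).smul_const _

theorem integral_sum_smul_const {ι E V : Type*} [Fintype ι] [MeasurableSpace E] {μ : Measure E}
    [NormedAddCommGroup V] [NormedSpace ℂ V] [CompleteSpace V] {f : ι → ι → E → ℂ}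
    (hf : ∀ j k, Integrable (f j k) μ) (N : ι → ι → V) :
    ∫ x, ∑ j, ∑ k, f j k x • N j k ∂μ = ∑ j, ∑ k, (∫ x, f j k x ∂μ) • N j k := by
  rw [integral_finsetSum _ fun j _ => integrable_finsetSum _ fun k _ => (hf j k).smul_const _]
  refine Finset.sum_congr rfl fun j _ => ?_
  rw [integral_finsetSum _ fun k _ => (hf j k).smul_const _]
  exact Finset.sum_congr rfl fun k _ => integral_smul_const _ _

/-- The coefficient of `|x|^{s-2} x_j x_k` in the Riesz kernel. -/
def rieszCoeff (n p : ℕ) (a b : ℂ) (j k : Fin n) : FormEnd n p :=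
  (if j = k then a else 0) • (1 : FormEnd n p) +
    (b - a) • extIntPair n p (Euc.basisVec j) (Euc.basisVec k)

theorem inner_basisVec_left {n : ℕ} (j : Fin n) (x : Euc n) :
    (inner ℝ (Euc.basisVec j) x : ℝ) = x j := by
  simp [Euc.basisVec, EuclideanSpace.inner_single_left]

theorem inner_basisVec_basisVec {n : ℕ} (j k : Fin n) :
    ((inner ℝ (Euc.basisVec j) (Euc.basisVec k) : ℝ) : ℂ) = if j = k then 1 else 0 := by
  rw [inner_basisVec_left]
  split_ifs with h <;> simp [Euc.basisVec, h]

theorem sum_sq_ofReal_eq_norm_sq {n : ℕ} (x : Euc n) :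
    ∑ j, (x j : ℂ) * (x j : ℂ) = (‖x‖ : ℂ) ^ 2 := by
  rw [← Complex.ofReal_pow, EuclideanSpace.real_norm_sq_eq]
  push_cast
  simp only [sq]

theorem rieszKernel_eq_sum (n p : ℕ) (a b s : ℂ) (x : Euc n) :
    rieszKernel n p a b s x = ∑ j, ∑ k,
      pairKernel (Euc.basisVec j) (Euc.basisVec k) s x • rieszCoeff n p a b j k := by
  have h1 : intExt n p x = ((‖x‖ : ℂ) ^ 2) • (1 : FormEnd n p) - extInt n p x :=
    eq_sub_of_add_eq (intExt_add_extInt n p x)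
  have h2 : rieszKernel n p a b s x = ((‖x‖ : ℂ) ^ (s - 2)) •
      ((a * (‖x‖ : ℂ) ^ 2) • (1 : FormEnd n p) + (b - a) • extInt n p x) := by
    rw [rieszKernel, h1]
    module
  rw [h2, extInt_eq_sum, smul_add_sum_smul_eq_sum _ _ _ _ _ _ _ (sum_sq_ofReal_eq_norm_sq x)]
  simp only [pairKernel, inner_basisVec_left, rieszCoeff]

theorem sum_rieszCoeff_self (n p : ℕ) (a b : ℂ) :
    ∑ j, rieszCoeff n p a b j j = (n * a + (b - a) * p) • (1 : FormEnd n p) := by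
  simp only [rieszCoeff, if_true, Finset.sum_add_distrib, ← Finset.smul_sum,
    sum_extIntPair_basisVec, Finset.sum_const, Finset.card_univ, Fintype.card_fin]
  rw [← Nat.cast_smul_eq_nsmul ℂ]
  module

theorem smul_rieszKernel_eq_sum (n p : ℕ) (a b s c : ℂ) (x : Euc n) :
    c • rieszKernel n p a b s x = ∑ j, ∑ k,
      (pairKernel (Euc.basisVec j) (Euc.basisVec k) s x * c) • rieszCoeff n p a b j k := by
  simp only [rieszKernel_eq_sum, Finset.smul_sum, smul_smul, mul_comm c]

theorem integrable_smul_rieszKernel {n : ℕ} (hn : 1 ≤ n) (p : ℕ) (a b : ℂ) {s : ℂ}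
    (hs : -(n : ℝ) < s.re) (φ : 𝓢(Euc n, ℂ)) :
    Integrable (fun x => φ x • rieszKernel n p a b s x) := by
  simp only [smul_rieszKernel_eq_sum]
  exact integrable_sum_smul_const (fun j k => integrable_pairKernel_mul hn _ _ hs φ) _

theorem integral_smul_rieszKernel {n : ℕ} (hn : 1 ≤ n) (p : ℕ) (a b : ℂ) {s : ℂ}
    (hs : -(n : ℝ) < s.re) (φ : 𝓢(Euc n, ℂ)) :
    ∫ x, φ x • rieszKernel n p a b s x = ∑ j, ∑ k,
      (∫ x, pairKernel (Euc.basisVec j) (Euc.basisVec k) s x * φ x) • rieszCoeff n p a b j k := by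
  simp only [smul_rieszKernel_eq_sum]
  exact integral_sum_smul_const (fun j k => integrable_pairKernel_mul hn _ _ hs φ) _

/-- Since `|x|² = ∑ x_j²`, the isotropic term of the scalar formula is itself a trace of pair
kernels. -/
theorem integral_norm_cpow_mul {n : ℕ} (hn : 1 ≤ n) {s : ℂ} (hs : -(n : ℝ) < s.re)
    (φ : 𝓢(Euc n, ℂ)) :
    ∫ x : Euc n, (‖x‖ : ℂ) ^ s * φ x =
      ∑ j, ∫ x, pairKernel (Euc.basisVec j) (Euc.basisVec j) s x * φ x := by
  have : Nonempty (Fin n) := ⟨⟨0, hn⟩⟩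
  have hne : ∀ᵐ x : Euc n, x ≠ 0 := compl_mem_ae_iff.mpr (measure_singleton 0)
  rw [← integral_finsetSum _ fun j _ => integrable_pairKernel_mul hn _ _ hs φ]
  refine integral_congr_ae ?_
  filter_upwards [hne] with x hx
  have hx' : (‖x‖ : ℂ) ≠ 0 := by simpa using hx
  simp only [pairKernel, inner_basisVec_left]
  rw [← Finset.sum_mul, ← Finset.mul_sum, sum_sq_ofReal_eq_norm_sq, Complex.cpow_sub _ _ hx',
    Complex.cpow_ofNat]
  field_simp

theorem integral_pairKernel_basisVec_mul_schwartzFourier {n : ℕ} (hn : 1 ≤ n) {s : ℂ}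
    (hs : -(n : ℝ) < s.re) (hs' : s.re < 0) (φ : 𝓢(Euc n, ℂ)) (j k : Fin n) :
    ∫ x, pairKernel (Euc.basisVec j) (Euc.basisVec k) s x * schwartzFourier n φ x =
      -rieszFourierConst n s * ((if j = k then 1 else 0) *
        (∑ l, ∫ x, pairKernel (Euc.basisVec l) (Euc.basisVec l) (-s - n) x * φ x) -
        (s + n) * ∫ x, pairKernel (Euc.basisVec j) (Euc.basisVec k) (-s - n) x * φ x) := by
  have hs2 : -(n : ℝ) < (-s - n : ℂ).re := by simp; linarith
  have hG : Complex.Gamma (1 - s / 2) ≠ 0 := by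
    refine Complex.Gamma_ne_zero_of_re_pos ?_
    simp; linarith
  have h := integral_pairKernel_mul_schwartzFourier hn (Euc.basisVec j) (Euc.basisVec k) hs hs' φ
  rw [integral_norm_cpow_mul hn hs2, inner_basisVec_basisVec] at h
  refine mul_left_cancel₀ hG (h.trans ?_)
  rw [rieszFourierConst, show -(s - 2) / 2 = 1 - s / 2 by ring]
  generalize (∑ l, ∫ x, pairKernel (Euc.basisVec l) (Euc.basisVec l) (-s - n) x * φ x) = S
  generalize (∫ x, pairKernel (Euc.basisVec j) (Euc.basisVec k) (-s - n) x * φ x) = S'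
  generalize (if j = k then (1 : ℂ) else 0) = δ
  generalize Complex.Gamma (1 - s / 2) = G at hG
  field_simp

/-- This is the origin of `C` and `D`: they satisfy `D - C = (s+n)(b-a)` and `C = (s+n)a - γ`, with
`γ = na + (b-a)p` the trace of the coefficients. -/
theorem rieszCoeff_eq_smul_sub (n p : ℕ) (a b s : ℂ) (j k : Fin n) :
    rieszCoeff n p ((s + p) * a - p * b) (-((n : ℂ) - p) * a + (s + n - p) * b) j k =
      (s + n) • rieszCoeff n p a b j k -
        (if j = k then n * a + (b - a) * p else 0) • (1 : FormEnd n p) :=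
  ite_smul_add_smul_eq_smul_sub _ _ (by ring) (by ring)

theorem integral_schwartzFourier_smul_rieszKernel {n : ℕ} (hn : 1 ≤ n) (p : ℕ) (a b : ℂ) {s : ℂ}
    (hs : -(n : ℝ) < s.re) (hs' : s.re < 0) (φ : 𝓢(Euc n, ℂ)) :
    ∫ x, schwartzFourier n φ x • rieszKernel n p a b s x =
      rieszFourierConst n s • ∫ x, φ x • rieszKernel n p ((s + p) * a - p * b)
        (-((n : ℂ) - p) * a + (s + n - p) * b) (-s - n) x := by
  have hs2 : -(n : ℝ) < (-s - n : ℂ).re := by simp; linarith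
  have h1 := integral_smul_rieszKernel hn p a b hs (schwartzFourier n φ)
  have h2 := integral_smul_rieszKernel hn p ((s + p) * a - p * b)
    (-((n : ℂ) - p) * a + (s + n - p) * b) hs2 φ
  have h3 := sum_smul_sub_trace_smul
    (fun j k => ∫ x, pairKernel (Euc.basisVec j) (Euc.basisVec k) (-s - n) x * φ x)
    (rieszCoeff n p a b) _ _ (rieszFourierConst n s) _ _ (sum_rieszCoeff_self n p a b)
    (rieszCoeff_eq_smul_sub n p a b s)
  simp only [integral_pairKernel_basisVec_mul_schwartzFourier hn hs hs'] at h1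
  exact h1.trans (h3.trans (congrArg (rieszFourierConst n s • ·) h2.symm))

/-! ### Meromorphic continuation through the functional equation. -/

theorem isOpen_re_gt (c : ℝ) : IsOpen {s : ℂ | c < s.re} :=
  isOpen_lt continuous_const Complex.continuous_re

theorem isOpen_re_lt (c : ℝ) : IsOpen {s : ℂ | s.re < c} :=
  isOpen_lt Complex.continuous_re continuous_const

theorem neg_natCast_lt_re_neg_sub {n : ℕ} {s : ℂ} (hs : s.re < 0) :
    -(n : ℝ) < (-s - n : ℂ).re := by
  simp; linarith

theorem rieszKernel_smul (n p : ℕ) (c a b s : ℂ) (x : Euc n) :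
    rieszKernel n p (c * a) (c * b) s x = c • rieszKernel n p a b s x := by
  rw [rieszKernel, rieszKernel, mul_smul, mul_smul, ← smul_add, smul_comm]

theorem Complex.analyticAt_Gamma_inv_comp {g : ℂ → ℂ} (hg : Differentiable ℂ g) (s : ℂ) :
    AnalyticAt ℂ (fun t => (Complex.Gamma (g t))⁻¹) s :=
  (Complex.differentiable_one_div_Gamma.comp hg).analyticAt s

theorem not_mem_rieszPoles_of_re {n : ℕ} {s : ℂ} (hs : -(n : ℝ) < s.re) : s ∉ rieszPoles n := by
  rintro ⟨k, rfl⟩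
  simp at hs
  have : (0 : ℝ) ≤ k := k.cast_nonneg
  linarith

theorem analyticAt_rieszFourierConst {n : ℕ} {s : ℂ} (hs : s ∉ rieszPoles n) :
    AnalyticAt ℂ (rieszFourierConst n) s := by
  -- `1/Γ` is entire, so `Γ` is handled as its inverse; it is nonzero away from the points of
  -- `rieszPoles n`.
  have h1 : AnalyticAt ℂ (fun t : ℂ => (Complex.Gamma ((t + n) / 2))⁻¹⁻¹) s := by
    refine (Complex.analyticAt_Gamma_inv_comp (by fun_prop) s).inv (inv_ne_zero ?_)
    refine Complex.Gamma_ne_zero fun m hm => hs ⟨m, ?_⟩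
    linear_combination 2 * hm
  simp only [inv_inv] at h1
  have h2 : AnalyticAt ℂ (fun t : ℂ => (Complex.Gamma (-(t - 2) / 2))⁻¹) s :=
    Complex.analyticAt_Gamma_inv_comp (by fun_prop) s
  have h3 : AnalyticAt ℂ (fun t : ℂ => (2 : ℂ) ^ (t + n - 1)) s :=
    Differentiable.analyticAt (f := fun t : ℂ => (2 : ℂ) ^ (t + n - 1))
      (fun t => ((differentiableAt_id.add_const _).sub_const _).const_cpow (Or.inl two_ne_zero)) s
  exact ((h3.mul analyticAt_const).mul (h1.mul h2)).neg

theorem meromorphicAt_rieszFourierConst (n : ℕ) (s : ℂ) :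
    MeromorphicAt (rieszFourierConst n) s := by
  have h1 : MeromorphicAt (fun t : ℂ => (Complex.Gamma ((t + n) / 2))⁻¹⁻¹) s :=
    (Complex.analyticAt_Gamma_inv_comp (by fun_prop) s).meromorphicAt.inv
  simp only [inv_inv] at h1
  have h2 : MeromorphicAt (fun t : ℂ => (Complex.Gamma (-(t - 2) / 2))⁻¹) s :=
    (Complex.analyticAt_Gamma_inv_comp (by fun_prop) s).meromorphicAt
  have h3 : AnalyticAt ℂ (fun t : ℂ => (2 : ℂ) ^ (t + n - 1)) s :=
    Differentiable.analyticAt (f := fun t : ℂ => (2 : ℂ) ^ (t + n - 1))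
      (fun t => ((differentiableAt_id.add_const _).sub_const _).const_cpow (Or.inl two_ne_zero)) s
  exact ((h3.meromorphicAt.mul (MeromorphicAt.const _ _)).mul (h1.mul h2)).neg

/-- After `Γ(z+1) = zΓ(z)` in both denominators the Gamma factors cancel, leaving `-4/(s(s+n))`; the
powers of two contribute `2^{n-2}`. -/
theorem rieszFourierConst_mul_reflect {n : ℕ} {s : ℂ} (hs : -(n : ℝ) < s.re) (hs' : s.re < 0) :
    rieszFourierConst n s * rieszFourierConst n (-s - n) * (-(s * (s + n))) =
      (2 * Real.pi : ℂ) ^ n := by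
  have hs0 : s ≠ 0 := fun h => by simp [h] at hs'
  have hsn : s + n ≠ 0 := fun h => by
    have := congrArg Complex.re h
    simp at this; linarith
  have hG1 : Complex.Gamma ((s + n) / 2) ≠ 0 := by
    refine Complex.Gamma_ne_zero_of_re_pos ?_
    simp; linarith
  have hG2 : Complex.Gamma (-s / 2) ≠ 0 := by
    refine Complex.Gamma_ne_zero_of_re_pos ?_
    simp; linarith
  have hpi : (Real.pi : ℂ) ≠ 0 := Complex.ofReal_ne_zero.mpr Real.pi_ne_zero
  have e1 : (2 : ℂ) ^ (s + n - 1) * (2 : ℂ) ^ (-s - n + n - 1) = 2 ^ n / 4 := by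
    rw [← Complex.cpow_add _ _ two_ne_zero, show s + n - 1 + (-s - n + n - 1) = (n : ℂ) - 2 by ring,
      Complex.cpow_sub _ _ two_ne_zero, Complex.cpow_natCast]
    norm_num
  have e2 : (Real.pi : ℂ) ^ ((n : ℂ) / 2) * (Real.pi : ℂ) ^ ((n : ℂ) / 2) = (Real.pi : ℂ) ^ n := by
    rw [← Complex.cpow_add _ _ hpi, add_halves, Complex.cpow_natCast]
  have e3 : Complex.Gamma (-(s - 2) / 2) = (-s / 2) * Complex.Gamma (-s / 2) := by
    rw [← Complex.Gamma_add_one _ (div_ne_zero (neg_ne_zero.mpr hs0) two_ne_zero)]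
    congr 1; ring
  have e4 : Complex.Gamma (-(-s - n - 2) / 2) = ((s + n) / 2) * Complex.Gamma ((s + n) / 2) := by
    rw [← Complex.Gamma_add_one _ (div_ne_zero hsn two_ne_zero)]
    congr 1; ring
  rw [rieszFourierConst, rieszFourierConst, e3, e4, show -s - (n : ℂ) + n = -s by ring, mul_pow]
  rw [show -s - (n : ℂ) + n - 1 = -s - 1 by ring] at e1
  generalize (2 : ℂ) ^ (s + n - 1) = X at *
  generalize (2 : ℂ) ^ (-s - 1) = Y at *
  generalize (Real.pi : ℂ) ^ ((n : ℂ) / 2) = Z at *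
  generalize Complex.Gamma ((s + n) / 2) = G at *
  generalize Complex.Gamma (-s / 2) = H at *
  rw [← e2]
  field_simp
  linear_combination 4 * Z ^ 2 * e1

theorem differentiableAt_integral_smul_rieszKernel {n : ℕ} (hn : 1 ≤ n) (p : ℕ) {A B : ℂ → ℂ}
    (hA : Differentiable ℂ A) (hB : Differentiable ℂ B) (φ : 𝓢(Euc n, ℂ)) {s : ℂ}
    (hs : -(n : ℝ) < s.re) :
    DifferentiableAt ℂ (fun t => ∫ x, φ x • rieszKernel n p (A t) (B t) t x) s := by
  have hN : ∀ j k, Differentiable ℂ (fun t => rieszCoeff n p (A t) (B t) j k) := fun j k => by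
    unfold rieszCoeff
    refine Differentiable.add (Differentiable.smul_const ?_ _) ((hB.sub hA).smul_const _)
    split_ifs
    · exact hA
    · exact differentiable_const 0
  have h : DifferentiableAt ℂ (fun t => ∑ j, ∑ k,
      (∫ x, pairKernel (Euc.basisVec j) (Euc.basisVec k) t x * φ x) •
        rieszCoeff n p (A t) (B t) j k) s :=
    DifferentiableAt.fun_sum fun j _ => DifferentiableAt.fun_sum fun k _ =>
      (differentiableAt_integral_pairKernel hn _ _ hs φ).smul (hN j k s)
  refine h.congr_of_eventuallyEq ?_
  filter_upwards [(isOpen_re_gt (-(n : ℝ))).mem_nhds hs] with t ht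
  exact integral_smul_rieszKernel hn p _ _ ht φ

theorem analyticAt_integral_smul_rieszKernel {n : ℕ} (hn : 1 ≤ n) (p : ℕ) {A B : ℂ → ℂ}
    (hA : Differentiable ℂ A) (hB : Differentiable ℂ B) (φ : 𝓢(Euc n, ℂ)) {s : ℂ}
    (hs : -(n : ℝ) < s.re) :
    AnalyticAt ℂ (fun t => ∫ x, φ x • rieszKernel n p (A t) (B t) t x) s :=
  DifferentiableOn.analyticAt (s := {t : ℂ | -(n : ℝ) < t.re})
    (fun _ ht => (differentiableAt_integral_smul_rieszKernel hn p hA hB φ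
      ht).differentiableWithinAt) ((isOpen_re_gt _).mem_nhds hs)

/-- The Riesz distribution in the range where its kernel is locally integrable. -/
def regularRiesz {n : ℕ} (hn : 1 ≤ n) (p : ℕ) (a b s : ℂ) (hs : -(n : ℝ) < s.re) :
    𝓢'(Euc n, FormEnd n p) :=
  ContinuousLinearMap.toPointwiseConvergenceCLM ℂ (RingHom.id ℂ) 𝓢(Euc n, ℂ) (FormEnd n p)
    (∑ j, ∑ k, (pairFunctional hn (Euc.basisVec j) (Euc.basisVec k) s hs).smulRight
      (rieszCoeff n p a b j k))

theorem regularRiesz_apply {n : ℕ} (hn : 1 ≤ n) (p : ℕ) (a b s : ℂ) (hs : -(n : ℝ) < s.re)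
    (φ : 𝓢(Euc n, ℂ)) :
    regularRiesz hn p a b s hs φ = ∫ x, φ x • rieszKernel n p a b s x := by
  rw [integral_smul_rieszKernel hn p a b hs]
  change (∑ j, ∑ k, (pairFunctional hn (Euc.basisVec j) (Euc.basisVec k) s hs).smulRight
      (rieszCoeff n p a b j k)) φ = _
  simp only [sum_apply, ContinuousLinearMap.smulRight_apply, pairFunctional_apply]

open Classical in
/-- The meromorphic continuation of the Riesz distributions, by the Fourier functional equation. -/
def rieszFamily {n : ℕ} (hn : 1 ≤ n) (p : ℕ) (a b s : ℂ) : 𝓢'(Euc n, FormEnd n p) :=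
  if hs : -(n : ℝ) < s.re then regularRiesz hn p a b s hs
  else if hs' : s.re < 0 then
    (((2 * Real.pi : ℂ) ^ n)⁻¹ * rieszFourierConst n s) • distFourier n
      (regularRiesz hn p ((s + p) * a - p * b) (-((n : ℂ) - p) * a + (s + n - p) * b) (-s - n)
        (neg_natCast_lt_re_neg_sub hs'))
  -- Never reached: `Re s ≤ -n` forces `Re s < 0`, as `n ≥ 1`.
  else 0

theorem rieszFamily_apply_of_lt_re {n : ℕ} (hn : 1 ≤ n) (p : ℕ) (a b : ℂ) {s : ℂ}
    (hs : -(n : ℝ) < s.re) (φ : 𝓢(Euc n, ℂ)) :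
    rieszFamily hn p a b s φ = ∫ x, φ x • rieszKernel n p a b s x := by
  rw [rieszFamily, dif_pos hs, regularRiesz_apply]

/-- This is the consistency of the two branches on the strip, where the functional equation at
`-s-n` inverts the one at `s`. -/
theorem rieszFamily_apply_of_re_neg {n : ℕ} (hn : 1 ≤ n) (p : ℕ) (a b : ℂ) {s : ℂ}
    (hs' : s.re < 0) (φ : 𝓢(Euc n, ℂ)) :
    rieszFamily hn p a b s φ = (((2 * Real.pi : ℂ) ^ n)⁻¹ * rieszFourierConst n s) •
      ∫ x, schwartzFourier n φ x • rieszKernel n p ((s + p) * a - p * b)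
        (-((n : ℂ) - p) * a + (s + n - p) * b) (-s - n) x := by
  by_cases hs : -(n : ℝ) < s.re
  · have hpi : (2 * Real.pi : ℂ) ^ n ≠ 0 :=
      pow_ne_zero _ (mul_ne_zero two_ne_zero (Complex.ofReal_ne_zero.mpr Real.pi_ne_zero))
    rw [rieszFamily_apply_of_lt_re hn p a b hs, integral_schwartzFourier_smul_rieszKernel hn p _ _
      (neg_natCast_lt_re_neg_sub hs') (by simp; linarith)]
    -- The matrix taking `(a, b)` to `(C, D)` has eigenvalues `s` and `s+n`; at `-s-n` they become
    -- `-s-n` and `-s` on the same eigenvectors. The product is the scalar `-s(s+n)`.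
    have e1 : (-s - n + p) * ((s + p) * a - p * b) -
        p * (-((n : ℂ) - p) * a + (s + n - p) * b) = (-(s * (s + n))) * a := by ring
    have e2 : -((n : ℂ) - p) * ((s + p) * a - p * b) +
        (-s - n + n - p) * (-((n : ℂ) - p) * a + (s + n - p) * b) = (-(s * (s + n))) * b := by ring
    rw [e1, e2, show -(-s - (n : ℂ)) - n = s by ring]
    simp only [rieszKernel_smul, smul_comm _ (-(s * (s + n)))]
    rw [integral_smul, smul_smul, smul_smul]
    have e3 : ((2 * Real.pi : ℂ) ^ n)⁻¹ * rieszFourierConst n s *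
        (rieszFourierConst n (-s - n) * (-(s * (s + n)))) = 1 := by
      rw [mul_assoc, ← mul_assoc (rieszFourierConst n s), rieszFourierConst_mul_reflect hs hs',
        inv_mul_cancel₀ hpi]
    rw [← mul_assoc] at e3
    rw [e3, one_smul]
  · rw [rieszFamily, dif_neg hs, dif_pos hs', ← regularRiesz_apply hn p _ _ _
      (neg_natCast_lt_re_neg_sub hs')]
    rfl

theorem meromorphicAt_rieszFamily_of_re_neg {n : ℕ} (hn : 1 ≤ n) (p : ℕ) {A B : ℂ → ℂ}
    (hA : Differentiable ℂ A) (hB : Differentiable ℂ B) (φ : 𝓢(Euc n, ℂ)) {s : ℂ}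
    (hs : s.re < 0) :
    MeromorphicAt (fun t => rieszFamily hn p (A t) (B t) t φ) s ∧
      (s ∉ rieszPoles n → AnalyticAt ℂ (fun t => rieszFamily hn p (A t) (B t) t φ) s) := by
  have hev : (fun t => rieszFamily hn p (A t) (B t) t φ) =ᶠ[𝓝 s]
      fun t => (((2 * Real.pi : ℂ) ^ n)⁻¹ * rieszFourierConst n t) •
        ∫ x, schwartzFourier n φ x • rieszKernel n p ((t + p) * A t - p * B t)
          (-((n : ℂ) - p) * A t + (t + n - p) * B t) (-t - n) x := by
    filter_upwards [(isOpen_re_lt 0).mem_nhds hs] with t ht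
    exact rieszFamily_apply_of_re_neg hn p _ _ ht φ
  -- The coefficients are rewritten as entire functions of `w = -t-n`, the exponent of the reflected
  -- kernel, and `w` is substituted back afterwards.
  have hw := analyticAt_integral_smul_rieszKernel hn p
    (A := fun w => (-w - n + p) * A (-w - n) - p * B (-w - n))
    (B := fun w => -((n : ℂ) - p) * A (-w - n) + (-w - n + n - p) * B (-w - n))
    (by fun_prop) (by fun_prop) (schwartzFourier n φ) (neg_natCast_lt_re_neg_sub (n := n) hs)
  have hr : AnalyticAt ℂ (fun t : ℂ => -t - (n : ℂ)) s := analyticAt_id.neg.sub analyticAt_const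
  have hc := AnalyticAt.fun_comp (f := fun t : ℂ => -t - (n : ℂ)) hw hr
  have hinv : ∀ t : ℂ, -(-t - (n : ℂ)) - n = t := fun t => by ring
  simp only [hinv] at hc
  constructor
  · exact (((MeromorphicAt.const _ _).mul (meromorphicAt_rieszFourierConst n s)).smul
      hc.meromorphicAt).congr (hev.symm.filter_mono nhdsWithin_le_nhds)
  · intro hp
    exact ((analyticAt_const.mul (analyticAt_rieszFourierConst hp)).smul hc).congr hev.symm

theorem analyticAt_rieszFamily_of_lt_re {n : ℕ} (hn : 1 ≤ n) (p : ℕ) {A B : ℂ → ℂ}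
    (hA : Differentiable ℂ A) (hB : Differentiable ℂ B) (φ : 𝓢(Euc n, ℂ)) {s : ℂ}
    (hs : -(n : ℝ) < s.re) : AnalyticAt ℂ (fun t => rieszFamily hn p (A t) (B t) t φ) s := by
  refine (analyticAt_integral_smul_rieszKernel hn p hA hB φ hs).congr ?_
  filter_upwards [(isOpen_re_gt (-(n : ℝ))).mem_nhds hs] with t ht
  exact (rieszFamily_apply_of_lt_re hn p _ _ ht φ).symm

theorem isRieszFamily_rieszFamily {n : ℕ} (hn : 1 ≤ n) (p : ℕ) :
    IsRieszFamily n p (rieszFamily hn p) := by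
  have hn' : -(n : ℝ) < 0 := by
    have : (1 : ℝ) ≤ n := by exact_mod_cast hn
    linarith
  refine ⟨fun a b s hs φ => integrable_smul_rieszKernel hn p a b hs φ,
    fun a b s hs φ => rieszFamily_apply_of_lt_re hn p a b hs φ, fun A B hA hB φ s hs => ?_,
    fun A B hA hB φ s => ?_⟩
  · by_cases h : -(n : ℝ) < s.re
    · exact analyticAt_rieszFamily_of_lt_re hn p hA hB φ h
    · exact (meromorphicAt_rieszFamily_of_re_neg hn p hA hB φ
        (lt_of_le_of_lt (not_lt.mp h) hn')).2 hs
  · by_cases h : -(n : ℝ) < s.re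
    · exact (analyticAt_rieszFamily_of_lt_re hn p hA hB φ h).meromorphicAt
    · exact (meromorphicAt_rieszFamily_of_re_neg hn p hA hB φ
        (lt_of_le_of_lt (not_lt.mp h) hn')).1

/-! ### The functional equation for any Riesz family, by the identity theorem. -/

theorem countable_rieszPoles (n : ℕ) : (rieszPoles n).Countable := by
  refine (Set.countable_range fun k : ℕ => -(n : ℂ) - 2 * (k : ℂ)).mono ?_
  rintro s ⟨k, rfl⟩
  exact ⟨k, rfl⟩

theorem neg_sub_not_mem_rieszPoles {n : ℕ} {s : ℂ} (hs : ∀ k : ℕ, s ≠ 2 * (k : ℂ)) :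
    -s - (n : ℂ) ∉ rieszPoles n := by
  rintro ⟨k, hk⟩
  exact hs k (by linear_combination -hk)

/-- Only the integral formula and analyticity of `R` enter, so no comparison with `rieszFamily` is
needed. -/
theorem IsRieszFamily.fourier_apply_eq {n p : ℕ} (hn : 1 ≤ n)
    {R : ℂ → ℂ → ℂ → 𝓢'(Euc n, FormEnd n p)} (hR : IsRieszFamily n p R) {A B C D : ℂ → ℂ}
    (hA : Differentiable ℂ A) (hB : Differentiable ℂ B)
    (hC : ∀ s, C s = (s + p) * A s - p * B s)
    (hD : ∀ s, D s = -((n : ℂ) - p) * A s + (s + n - p) * B s) {s : ℂ} (hs : s ∉ rieszPoles n)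
    (hs' : ∀ k : ℕ, s ≠ 2 * (k : ℂ)) (φ : 𝓢(Euc n, ℂ)) :
    R (A s) (B s) s (schwartzFourier n φ) =
      rieszFourierConst n s • R (C s) (D s) (-s - n) φ := by
  have hn' : (1 : ℝ) ≤ n := by exact_mod_cast hn
  have hCd : Differentiable ℂ C := by
    rw [funext hC]; fun_prop
  have hDd : Differentiable ℂ D := by
    rw [funext hD]; fun_prop
  set S : Set ℂ := rieszPoles n ∪ Set.range fun k : ℕ => 2 * (k : ℂ) with hS
  have hSc : S.Countable := (countable_rieszPoles n).union (Set.countable_range _)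
  have hconn : IsPreconnected Sᶜ :=
    (hSc.isConnected_compl_of_one_lt_rank (by simp)).isPreconnected
  have hmem : ∀ t ∈ Sᶜ, t ∉ rieszPoles n ∧ ∀ k : ℕ, t ≠ 2 * (k : ℂ) := fun t ht =>
    ⟨fun h => ht (Or.inl h), fun k h => ht (Or.inr ⟨k, h.symm⟩)⟩
  have hL : AnalyticOnNhd ℂ (fun t => R (A t) (B t) t (schwartzFourier n φ)) Sᶜ := fun t ht =>
    hR.analyticAt A B hA hB _ t (hmem t ht).1
  have hRt : AnalyticOnNhd ℂ (fun t => rieszFourierConst n t • R (C t) (D t) (-t - n) φ) Sᶜ := by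
    intro t ht
    have hw := hR.analyticAt (fun w => C (-w - n)) (fun w => D (-w - n)) (by fun_prop)
      (by fun_prop) φ (-t - n) (neg_sub_not_mem_rieszPoles (hmem t ht).2)
    have hr : AnalyticAt ℂ (fun t : ℂ => -t - (n : ℂ)) t := analyticAt_id.neg.sub analyticAt_const
    have hc := AnalyticAt.fun_comp (f := fun t : ℂ => -t - (n : ℂ)) hw hr
    have hinv : ∀ t : ℂ, -(-t - (n : ℂ)) - n = t := fun t => by ring
    simp only [hinv] at hc
    exact (analyticAt_rieszFourierConst (hmem t ht).1).smul hc
  -- The base point `-1/2` lies in the strip for every `n ≥ 1`.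
  have hz1 : -(n : ℝ) < (-1 / 2 : ℂ).re := by norm_num; linarith
  have hz2 : (-1 / 2 : ℂ).re < 0 := by norm_num
  have hz : (-1 / 2 : ℂ) ∈ Sᶜ := by
    rintro (h | ⟨k, hk⟩)
    · exact not_mem_rieszPoles_of_re hz1 h
    · rw [← hk] at hz2
      simp at hz2
      have : (0 : ℝ) ≤ k := k.cast_nonneg
      linarith
  refine hL.eqOn_of_preconnected_of_eventuallyEq hRt hconn hz ?_ (show s ∈ Sᶜ from ?_)
  · filter_upwards [(isOpen_re_gt _).mem_nhds hz1, (isOpen_re_lt 0).mem_nhds hz2] with t ht1 ht2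
    rw [hR.eq_integral _ _ _ ht1, hR.eq_integral _ _ _ (neg_natCast_lt_re_neg_sub ht2), hC, hD]
    exact integral_schwartzFourier_smul_rieszKernel hn p _ _ ht1 ht2 φ
  · rintro (h | ⟨k, hk⟩)
    · exact hs h
    · exact hs' k hk.symm

/-- The unit ball around `2k` meets no other even integer, and `Re s > -1 ≥ -n` keeps it away from
the poles. -/
theorem eventually_nhdsNE_two_mul_natCast (k : ℕ) :
    ∀ᶠ s : ℂ in 𝓝[≠] (2 * (k : ℂ)), -1 < s.re ∧ ∀ m : ℕ, s ≠ 2 * (m : ℂ) := by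
  have hball := nhdsWithin_le_nhds (s := {2 * (k : ℂ)}ᶜ)
    (Metric.ball_mem_nhds (2 * (k : ℂ)) one_pos)
  filter_upwards [hball, self_mem_nhdsWithin] with s hs hne
  rw [Metric.mem_ball, dist_eq_norm] at hs
  have hre := lt_of_le_of_lt (Complex.abs_re_le_norm _) hs
  simp only [Complex.sub_re, Complex.mul_re, Complex.re_ofNat, Complex.natCast_re, Complex.im_ofNat,
    Complex.natCast_im, mul_zero, sub_zero] at hre
  rw [abs_lt] at hre
  have hk : (0 : ℝ) ≤ k := k.cast_nonneg
  refine ⟨by linarith, fun m hm => hne ?_⟩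
  subst hm
  simp only [Complex.mul_re, Complex.re_ofNat, Complex.natCast_re, Complex.im_ofNat,
    Complex.natCast_im, mul_zero, sub_zero] at hre
  have h1 : (m : ℝ) < k + 1 := by linarith
  have h2 : (k : ℝ) < m + 1 := by linarith
  have : m = k := by
    have h1' : m < k + 1 := by exact_mod_cast h1
    have h2' : k < m + 1 := by exact_mod_cast h2
    omega
  rw [this]; rfl

end

theorem theorem3p1 (n p : ℕ) (hn : 1 ≤ n) (hp : p ≤ n) :
    (∃ R : ℂ → ℂ → ℂ → 𝓢'(Euc n, FormEnd n p), IsRieszFamily n p R) ∧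
    ∀ R : ℂ → ℂ → ℂ → 𝓢'(Euc n, FormEnd n p), IsRieszFamily n p R →
      ∀ A B C D : ℂ → ℂ, Differentiable ℂ A → Differentiable ℂ B →
        (∀ s, C s = (s + p) * A s - p * B s) →
        (∀ s, D s = -((n : ℂ) - p) * A s + (s + n - p) * B s) →
        (∀ s : ℂ, s ∉ rieszPoles n → (∀ k : ℕ, s ≠ 2 * (k : ℂ)) →
          distFourier n (R (A s) (B s) s) =
            rieszFourierConst n s • R (C s) (D s) (-s - n)) ∧
        (∀ (k : ℕ) (φ : 𝓢(Euc n, ℂ)),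
          Tendsto (fun s : ℂ => rieszFourierConst n s • R (C s) (D s) (-s - n) φ)
            (𝓝[≠] (2 * (k : ℂ)))
            (𝓝 (distFourier n (R (A (2 * (k : ℂ))) (B (2 * (k : ℂ))) (2 * (k : ℂ))) φ))) := by
  refine ⟨⟨rieszFamily hn p, isRieszFamily_rieszFamily hn p⟩, ?_⟩
  intro R hR A B C D hA hB hC hD
  have hn' : (1 : ℝ) ≤ n := by exact_mod_cast hn
  refine ⟨fun s hs hs' => ?_, fun k φ => ?_⟩
  · ext1 φ
    exact hR.fourier_apply_eq hn hA hB hC hD hs hs' φ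
  · have hk : -(n : ℝ) < (2 * (k : ℂ)).re := by
      have : (0 : ℝ) ≤ k := k.cast_nonneg
      simp
      linarith
    -- The left side is analytic at `2k`, and it equals the right side at nearby points other than
    -- `2k`.
    have hcont := (hR.analyticAt A B hA hB (schwartzFourier n φ) _
      (not_mem_rieszPoles_of_re hk)).continuousAt
    refine (hcont.tendsto.mono_left nhdsWithin_le_nhds).congr' ?_
    filter_upwards [eventually_nhdsNE_two_mul_natCast k] with s hs
    exact hR.fourier_apply_eq hn hA hB hC hD (not_mem_rieszPoles_of_re (by linarith [hs.1])) hs.2 φ
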